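/- For $\mathrm{Re}\,z>0$ put $\varphi_1(z)=\frac1{e^z-1}-\frac1z$ and $$A(z)=\int_0^\infty \varphi_1(xz)\,\varphi_1(x)\,dx .$$ This integral converges absolutely, and $A$ has an analytic continuation to $\mathbb C\setminus(-\infty,0]$, still denoted $A$. For an integer $k\ge1$ let $\delta_1(u_1\cdots u_k)\,du_1\cdots du_k$ denote the surface measure carried by $\{u\in\mathbb R_{>0}^k : u_1\cdots u_k=1\}$ which, seen as a distribution, is the limit as $\varepsilon\to0^+$ of $\varepsilon^{-1}\mathbf 1_{\{1\le u_1\cdots u_k\le 1+\varepsilon\}}\,du_1\cdots du_k$ on $\mathbb R_{>0}^k$; in the coordinates $u_1,\dots,u_{k-1}$ it is $\frac{du_1\cdots du_{k-1}}{u_1\cdots u_{k-1}}$, and for $k=1$ it is the Dirac mass at $1$. Then for every integer $k\ge1$ and every $\delta\in(0,\pi)$, $$\int_{-\infty}^{\infty}\left|\zeta\left(\tfrac12+it\right)\right|^{2k}\frac{e^{k(\pi-\delta)t}}{\cosh(\pi t)^k}\,dt =2\,\frac{e^{ik(\delta-\pi)/2}}{\pi^{k-1}}\int_{\mathbb R_{>0}^k}\prod_{j=1}^k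 A(-u_je^{i\delta})\;\delta_1\Big(\prod_{j=1}^k u_j\Big)\prod_{j=1}^k du_j ,$$ both integrals being absolutely convergent. -/

import Mathlib

open MeasureTheory Set Filter Topology

/-- `φ₁(z) = 1/(e^z - 1) - 1/z`, used only at points with positive real part. -/
noncomputable def phi1 (z : ℂ) : ℂ := 1 / (Complex.exp z - 1) - 1 / z

/-- The autocorrelation `∫₀^∞ φ₁(xz) φ₁(x) dx`, used for `Re z > 0`. -/
noncomputable def autocorr (z : ℂ) : ℂ :=
  ∫ x in Ioi (0 : ℝ), phi1 ((x : ℂ) * z) * phi1 (x : ℂ)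

/-- `A` is the analytic continuation of the autocorrelation from the right half-plane to
`ℂ ∖ (-∞, 0]`.  The values of `A` on `(-∞, 0]` are irrelevant. -/
def IsAutocorrContinuation (A : ℂ → ℂ) : Prop :=
  DifferentiableOn ℂ A Complex.slitPlane ∧ ∀ z : ℂ, 0 < z.re → A z = autocorr z

/-- The parametrization of `{u ∈ (0,∞)^k : u₁ ⋯ u_k = 1}` (for `k ≥ 1`) by its first `k - 1`
coordinates: `(u₁, …, u_{k-1}) ↦ (u₁, …, u_{k-1}, (u₁ ⋯ u_{k-1})⁻¹)`. -/
noncomputable def surfaceParam (k : ℕ) (u : Fin (k - 1) → ℝ) : Fin k → ℝ :=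
  fun i => if h : (i : ℕ) < k - 1 then u ⟨i, h⟩ else (∏ j, u j)⁻¹

/-- The (Gelfand–Leray) surface measure `δ₁(u₁ ⋯ u_k) du₁ ⋯ du_k` on
`{u ∈ (0,∞)^k : u₁ ⋯ u_k = 1}`, for `k ≥ 1`: with `f(u) = u₁ ⋯ u_k` it is
`du₁ ⋯ du_{k-1} / |∂f/∂u_k|`, where `∂f/∂u_k = u₁ ⋯ u_{k-1}`. -/
noncomputable def surfaceMeasure (k : ℕ) : Measure (Fin k → ℝ) :=
  (((volume : Measure (Fin (k - 1) → ℝ)).restrict {u | ∀ j, 0 < u j}).withDensity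
    (fun u => ENNReal.ofReal ((∏ j, u j)⁻¹))).map (surfaceParam k)

/-! ### Holomorphic parameter integrals and the identity theorem -/

/-- A dominated parameter integral of holomorphic functions is holomorphic. -/
theorem differentiableOn_integral_of_dominated {α : Type*} [MeasurableSpace α] {μ : Measure α}
    {U : Set ℂ} (hU : IsOpen U) {F : ℂ → α → ℂ}
    (hmeas : ∀ z ∈ U, AEStronglyMeasurable (F z) μ)
    (hdiff : ∀ᵐ a ∂μ, DifferentiableOn ℂ (fun z => F z a) U)
    (hbound : ∀ z₀ ∈ U, ∃ b : α → ℝ, Integrable b μ ∧ ∃ V ∈ 𝓝 z₀,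
      ∀ᵐ a ∂μ, ∀ z ∈ V, ‖F z a‖ ≤ b a) :
    DifferentiableOn ℂ (fun z => ∫ a, F z a ∂μ) U := by
  intro z₀ hz₀
  obtain ⟨b, hb, V, hV, hle⟩ := hbound z₀ hz₀
  obtain ⟨ε, hε, hball⟩ := Metric.mem_nhds_iff.1 (inter_mem hV (hU.mem_nhds hz₀))
  -- Halving the radius leaves room for Cauchy's estimate on circles of radius ε/2, which bounds the
  -- derivative by b/(ε/2).
  have hsub : ∀ z ∈ Metric.ball z₀ (ε / 2), Metric.closedBall z (ε / 2) ⊆ V ∩ U := fun z hz =>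
    (Metric.closedBall_subset_ball' (by rw [Metric.mem_ball] at hz; linarith)).trans hball
  have hz₀b : Metric.ball z₀ (ε / 2) ∈ 𝓝 z₀ := Metric.ball_mem_nhds _ (by positivity)
  have hderiv : ∀ᵐ a ∂μ, ∀ z ∈ Metric.ball z₀ (ε / 2),
      HasDerivAt (fun z => F z a) (deriv (fun z => F z a) z) z := by
    filter_upwards [hdiff] with a ha z hz
    exact (ha.differentiableAt (hU.mem_nhds
      (hsub z hz (Metric.mem_closedBall_self (by positivity))).2)).hasDerivAt
  refine (hasDerivAt_integral_of_dominated_loc_of_deriv_le (F := F)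
    (F' := fun z a => deriv (fun z => F z a) z) (bound := fun a => b a / (ε / 2))
    hz₀b ?_ ?_ ?_ ?_ (hb.div_const _) hderiv).2.differentiableAt.differentiableWithinAt
  · filter_upwards [hU.mem_nhds hz₀] with z hz using hmeas z hz
  · exact hb.mono' (hmeas z₀ hz₀) (hle.mono fun a ha => ha z₀ (mem_of_mem_nhds hV))
  -- The derivative at z₀ is measurable in the parameter as a limit of slopes along a sequence;
  -- shifting by N keeps that sequence in U.
  · have hseq : Tendsto (fun n : ℕ => z₀ + ((ε / 2 : ℝ) : ℂ) * (1 / ((n : ℂ) + 1))) atTop (𝓝[≠] z₀) := by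
      refine tendsto_nhdsWithin_iff.2 ⟨?_, Eventually.of_forall fun n => ?_⟩
      · simpa using (tendsto_one_div_add_atTop_nhds_zero_nat (𝕜 := ℂ)).const_mul
          (((ε / 2 : ℝ) : ℂ)) |>.const_add z₀
      · have : (n : ℂ) + 1 ≠ 0 := by exact_mod_cast n.succ_ne_zero
        simp [hε.ne', this]
    have hsub' := (hseq.mono_right nhdsWithin_le_nhds).eventually (hU.mem_nhds hz₀)
    obtain ⟨N, hN⟩ := eventually_atTop.1 hsub'
    have hseqN := hseq.comp (tendsto_add_atTop_nat N)
    refine aestronglyMeasurable_of_tendsto_ae atTop (f := fun n a => slope (fun z => F z a) z₀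
      (z₀ + ((ε / 2 : ℝ) : ℂ) * (1 / (((n + N : ℕ) : ℂ) + 1)))) (fun n => ?_) ?_
    · simp only [slope, vsub_eq_sub]
      exact AEStronglyMeasurable.const_smul
        ((hmeas _ (hN (n + N) (Nat.le_add_left N n))).sub (hmeas _ hz₀)) (_ : ℂ)
    · filter_upwards [hderiv] with a ha
      exact (hasDerivAt_iff_tendsto_slope.1 (ha z₀ (mem_of_mem_nhds hz₀b))).comp hseqN
  · filter_upwards [hle, hdiff] with a ha hd z hz
    refine Complex.norm_deriv_le_of_forall_mem_sphere_norm_le (by positivity) ?_ fun w hw =>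
      ha w (hsub z hz (Metric.sphere_subset_closedBall hw)).1
    exact (hd.mono ((hsub z hz).trans inter_subset_right)).diffContOnCl_ball subset_rfl

/-- Two holomorphic functions on a preconnected open set which agree on an interval of the real
line near a point of that set agree on the whole set. -/
theorem eqOn_of_eqOn_real {U : Set ℂ} (hU : IsOpen U) (hc : IsPreconnected U) {f g : ℂ → ℂ}
    (hf : DifferentiableOn ℂ f U) (hg : DifferentiableOn ℂ g U) {x : ℝ} (hx : (x : ℂ) ∈ U)
    (h : ∀ᶠ y : ℝ in 𝓝 x, f y = g y) : EqOn f g U := by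
  refine (hf.analyticOnNhd hU).eqOn_of_preconnected_of_frequently_eq (hg.analyticOnNhd hU) hc hx ?_
  have ht : Tendsto (fun y : ℝ => (y : ℂ)) (𝓝[≠] x) (𝓝[≠] (x : ℂ)) := by
    refine tendsto_nhdsWithin_iff.2 ⟨?_, ?_⟩
    · exact (Complex.continuous_ofReal.tendsto x).mono_left nhdsWithin_le_nhds
    · filter_upwards [self_mem_nhdsWithin] with y hy
      simpa using hy
  exact ht.frequently (h.filter_mono nhdsWithin_le_nhds).frequently

theorem isOpen_re_pos : IsOpen {z : ℂ | 0 < z.re} := isOpen_lt continuous_const Complex.continuous_re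

theorem isPreconnected_re_pos : IsPreconnected {z : ℂ | 0 < z.re} :=
  (convex_halfSpace_re_gt 0).isPreconnected

/-! ### Bounds for φ₁ on the right half-plane -/

theorem exp_ne_one_of_re_pos {z : ℂ} (hz : 0 < z.re) : Complex.exp z ≠ 1 := by
  intro h
  have := congrArg norm h
  rw [Complex.norm_exp, norm_one, Real.exp_eq_one_iff] at this
  exact hz.ne' this

theorem measurable_phi1 : Measurable phi1 := by
  unfold phi1; fun_prop

theorem differentiableOn_phi1 : DifferentiableOn ℂ phi1 {z | 0 < z.re} := by
  intro z hz
  have h1 : Complex.exp z - 1 ≠ 0 := sub_ne_zero.2 (exp_ne_one_of_re_pos hz)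
  have h2 : z ≠ 0 := by rintro rfl; simp at hz
  unfold phi1
  exact DifferentiableAt.differentiableWithinAt (by fun_prop (disch := assumption))

/-- On a sector `‖z‖ ≤ C Re z` the function `φ₁` is bounded and `O(1/‖z‖)`. -/
theorem norm_phi1_le {z : ℂ} {C : ℝ} (hz : 0 < z.re) (hC : ‖z‖ ≤ C * z.re) :
    ‖phi1 z‖ ≤ 2 * (C + 1) * min 1 (‖z‖⁻¹) := by
  have h0 : 0 < ‖z‖ := norm_pos_iff.2 (by rintro rfl; simp at hz)
  have hre : z.re ≤ ‖z‖ := Complex.re_le_norm z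
  have hC1 : 1 ≤ C := by
    by_contra! h
    nlinarith
  have hne : Complex.exp z - 1 ≠ 0 := sub_ne_zero.2 (exp_ne_one_of_re_pos hz)
  have hz0 : z ≠ 0 := norm_pos_iff.1 h0
  rcases le_total ‖z‖ (1 / 2) with h | h
  · have h1 : ‖Complex.exp z - 1 - z‖ ≤ ‖z‖ ^ 2 :=
      Complex.norm_exp_sub_one_sub_id_le (by linarith)
    have h2 : ‖z‖ / 2 ≤ ‖Complex.exp z - 1‖ := by
      have := norm_sub_norm_le z (-(Complex.exp z - 1 - z))
      rw [norm_neg] at this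
      have h3 : z - -(Complex.exp z - 1 - z) = Complex.exp z - 1 := by ring
      rw [h3] at this
      nlinarith
    have h3 : phi1 z = -(Complex.exp z - 1 - z) / (z * (Complex.exp z - 1)) := by
      unfold phi1; field_simp; ring
    have h4 : ‖phi1 z‖ ≤ 2 := by
      rw [h3, norm_div, norm_neg, norm_mul, div_le_iff₀ (mul_pos h0 (norm_pos_iff.2 hne))]
      nlinarith
    have h5 : min 1 (‖z‖⁻¹) = 1 := min_eq_left ((one_le_inv₀ h0).2 (by linarith))
    rw [h5]; linarith
  -- Away from 0, |e^z - 1| ≥ e^{Re z} - 1 ≥ Re z ≥ |z|/C by the sector condition.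
  · have h1 : z.re ≤ ‖Complex.exp z - 1‖ := by
      have := norm_sub_norm_le (Complex.exp z) 1
      rw [Complex.norm_exp, norm_one] at this
      linarith [Real.add_one_le_exp z.re]
    have h2 : ‖phi1 z‖ ≤ (C + 1) * ‖z‖⁻¹ := by
      calc ‖phi1 z‖ ≤ ‖1 / (Complex.exp z - 1)‖ + ‖1 / z‖ := norm_sub_le _ _
        _ = ‖Complex.exp z - 1‖⁻¹ + ‖z‖⁻¹ := by simp
        _ ≤ C * ‖z‖⁻¹ + ‖z‖⁻¹ := by
          gcongr
          rw [inv_le_comm₀ (norm_pos_iff.2 hne) (by positivity)]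
          refine le_trans ?_ h1
          rw [mul_inv, inv_inv, ← div_eq_inv_mul, div_le_iff₀ (by linarith)]
          linarith
        _ = _ := by ring
    have h3 : ‖z‖⁻¹ ≤ 2 := by
      rw [inv_le_comm₀ h0 (by norm_num)]; linarith
    have h4 : ‖z‖⁻¹ ≤ 2 * min 1 (‖z‖⁻¹) := by
      rw [mul_min_of_nonneg _ _ (by norm_num)]
      exact le_min (by linarith) (by linarith [inv_pos.2 h0])
    calc _ ≤ _ := h2
      _ ≤ (C + 1) * (2 * min 1 (‖z‖⁻¹)) := by gcongr
      _ = _ := by ring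

/-- The bound for `φ₁` along rays, locally uniform in the direction. -/
theorem exists_norm_phi1_ray_le {z₀ : ℂ} (hz₀ : 0 < z₀.re) :
    ∃ K : ℝ, 0 < K ∧ ∃ V ∈ 𝓝 z₀, ∀ z ∈ V, 0 < z.re ∧
      ∀ x : ℝ, 0 < x → ‖phi1 (x * z)‖ ≤ K * min 1 x⁻¹ := by
  set a := z₀.re / 2 with ha
  set b := ‖z₀‖ + 1 with hb
  have ha0 : 0 < a := by positivity
  have hb0 : 0 < b := by positivity
  -- The ratio b/a controls the aperture of the sector, and max 1 a⁻¹ turns |xz|⁻¹ into x⁻¹.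
  refine ⟨2 * (b / a + 1) * max 1 a⁻¹, by positivity, {z | a < z.re} ∩ {z | ‖z‖ < b},
    inter_mem ((isOpen_lt continuous_const Complex.continuous_re).mem_nhds
      (by simp [ha]; linarith))
      ((isOpen_lt continuous_norm continuous_const).mem_nhds (by simp [hb])), ?_⟩
  rintro z ⟨hz1, hz2⟩
  simp only [mem_ofPred_eq] at hz1 hz2
  refine ⟨ha0.trans hz1, fun x hx => ?_⟩
  have hre : ((x : ℂ) * z).re = x * z.re := by simp
  have hno : ‖(x : ℂ) * z‖ = x * ‖z‖ := by simp [abs_of_pos hx]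
  refine (norm_phi1_le (C := b / a) (by rw [hre]; exact mul_pos hx (ha0.trans hz1)) ?_).trans ?_
  · rw [hno, hre]
    have : ‖z‖ ≤ b / a * z.re := by
      rw [div_mul_eq_mul_div, le_div_iff₀ ha0]
      nlinarith
    nlinarith
  · rw [mul_assoc _ (max 1 a⁻¹)]
    gcongr
    have haz : a ≤ ‖z‖ := hz1.le.trans (Complex.re_le_norm z)
    rw [mul_min_of_nonneg _ _ (by positivity)]
    refine min_le_min (by simp) ?_
    rw [hno, mul_inv, mul_comm]
    gcongr
    exact (inv_anti₀ ha0 haz).trans (le_max_right _ _)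

theorem integrableOn_rpow_mul_min {σ : ℝ} (h0 : 0 < σ) (h1 : σ < 1) :
    IntegrableOn (fun x : ℝ => x ^ (σ - 1) * min 1 x⁻¹) (Ioi 0) := by
  have hm : ∀ s : Set ℝ, AEStronglyMeasurable (fun x : ℝ => x ^ (σ - 1) * min 1 x⁻¹)
      (volume.restrict s) := fun s => by
    exact Measurable.aestronglyMeasurable (by fun_prop)
  rw [← Ioc_union_Ioi_eq_Ioi (zero_le_one' ℝ)]
  refine IntegrableOn.union ?_ ?_
  · have : IntegrableOn (fun x : ℝ => x ^ (σ - 1)) (Ioc 0 1) :=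
      (intervalIntegrable_iff_integrableOn_Ioc_of_le zero_le_one).1
        (intervalIntegral.intervalIntegrable_rpow' (by linarith))
    refine this.mono' (hm _) ((ae_restrict_iff' measurableSet_Ioc).2 (ae_of_all _ fun x hx => ?_))
    have hx0 : 0 < x := hx.1
    rw [Real.norm_of_nonneg (by positivity)]
    exact mul_le_of_le_one_right (by positivity) (min_le_left _ _)
  · have : IntegrableOn (fun x : ℝ => x ^ (σ - 2)) (Ioi 1) :=
      integrableOn_Ioi_rpow_of_lt (by linarith) one_pos
    refine this.mono' (hm _) ((ae_restrict_iff' measurableSet_Ioi).2 (ae_of_all _ fun x hx => ?_))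
    have hx0 : 0 < x := one_pos.trans hx
    rw [Real.norm_of_nonneg (by positivity)]
    calc x ^ (σ - 1) * min 1 x⁻¹ ≤ x ^ (σ - 1) * x⁻¹ := by gcongr; exact min_le_right _ _
      _ = x ^ (σ - 2) := by
        rw [← Real.rpow_neg_one x, ← Real.rpow_add hx0]; ring_nf

theorem integrableOn_min_sq :
    IntegrableOn (fun x : ℝ => min 1 x⁻¹ * min 1 x⁻¹) (Ioi 0) := by
  -- One of the two factors is at most x^(-1/2).
  refine (integrableOn_rpow_mul_min (σ := 1 / 2) (by norm_num) (by norm_num)).mono'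
    (Measurable.aestronglyMeasurable (by fun_prop))
    ((ae_restrict_iff' measurableSet_Ioi).2 (ae_of_all _ fun x hx => ?_))
  have hx0 : (0 : ℝ) < x := hx
  rw [Real.norm_of_nonneg (by positivity)]
  gcongr
  rcases le_total x 1 with h | h
  · exact (min_le_left _ _).trans (Real.one_le_rpow_of_pos_of_le_one_of_nonpos hx0 h (by norm_num))
  · refine (min_le_right _ _).trans ?_
    rw [← Real.rpow_neg_one]
    exact Real.rpow_le_rpow_of_exponent_le h (by norm_num)

theorem measurable_phi1_ray (z : ℂ) : Measurable fun x : ℝ => phi1 (x * z) :=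
  measurable_phi1.comp (by fun_prop)

/-- The integrand of the autocorrelation, in the symmetric form `φ₁(xp) φ₁(xq)`. -/
theorem integrableOn_phi1_mul_phi1 {p q : ℂ} (hp : 0 < p.re) (hq : 0 < q.re) :
    IntegrableOn (fun x : ℝ => phi1 (x * p) * phi1 (x * q)) (Ioi 0) := by
  obtain ⟨K, hK, V, hV, h⟩ := exists_norm_phi1_ray_le hp
  obtain ⟨K', hK', V', hV', h'⟩ := exists_norm_phi1_ray_le hq
  refine (integrableOn_min_sq.const_mul (K * K')).mono'
    ((measurable_phi1_ray p).mul (measurable_phi1_ray q)).aestronglyMeasurable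
    ((ae_restrict_iff' measurableSet_Ioi).2 (ae_of_all _ fun x hx => ?_))
  rw [norm_mul]
  calc _ ≤ (K * min 1 x⁻¹) * (K' * min 1 x⁻¹) := by
        gcongr
        · have : (0 : ℝ) < x := hx
          positivity
        · exact (h p (mem_of_mem_nhds hV)).2 x hx
        · exact (h' q (mem_of_mem_nhds hV')).2 x hx
    _ = _ := by ring

/-! ### The correlation of φ₁ and its continuation -/

/-- The bilinear correlation `∫₀^∞ φ₁(xp) φ₁(xq) dx`. -/
noncomputable def phi1Corr (p q : ℂ) : ℂ := ∫ x in Ioi (0 : ℝ), phi1 (x * p) * phi1 (x * q)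

/-- Substituting x ↦ cx. This homogeneity is what relates the symmetric form to the autocorrelation.
-/
theorem phi1Corr_scale (p q : ℂ) {c : ℝ} (hc : 0 < c) :
    phi1Corr (c * p) (c * q) = (c : ℂ)⁻¹ * phi1Corr p q := by
  have := integral_comp_mul_left_Ioi (fun x : ℝ => phi1 (x * p) * phi1 (x * q)) 0 hc
  rw [mul_zero] at this
  unfold phi1Corr
  rw [Complex.real_smul, Complex.ofReal_inv] at this
  rw [← this]
  congr 1 with x
  push_cast
  congr 2 <;> ring

theorem differentiableOn_phi1Corr_comp {U : Set ℂ} (hU : IsOpen U) {p q : ℂ → ℂ}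
    (hp : DifferentiableOn ℂ p U) (hq : DifferentiableOn ℂ q U)
    (hp0 : ∀ z ∈ U, 0 < (p z).re) (hq0 : ∀ z ∈ U, 0 < (q z).re) :
    DifferentiableOn ℂ (fun z => phi1Corr (p z) (q z)) U := by
  unfold phi1Corr
  refine differentiableOn_integral_of_dominated hU
    (F := fun z (x : ℝ) => phi1 ((x : ℂ) * p z) * phi1 ((x : ℂ) * q z))
    (fun z hz => (integrableOn_phi1_mul_phi1 (hp0 z hz) (hq0 z hz)).aestronglyMeasurable)
    ((ae_restrict_iff' measurableSet_Ioi).2 (ae_of_all _ fun x hx => ?_)) fun z hz => ?_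
  · have hx0 : (0 : ℝ) < x := hx
    refine DifferentiableOn.mul ?_ ?_
    · exact differentiableOn_phi1.comp (hp.const_mul _) fun z hz => by
        simpa using mul_pos hx0 (hp0 z hz)
    · exact differentiableOn_phi1.comp (hq.const_mul _) fun z hz => by
        simpa using mul_pos hx0 (hq0 z hz)
  · obtain ⟨K, hK, V, hV, h⟩ := exists_norm_phi1_ray_le (hp0 z hz)
    obtain ⟨K', hK', V', hV', h'⟩ := exists_norm_phi1_ray_le (hq0 z hz)
    refine ⟨fun x => K * K' * (min 1 x⁻¹ * min 1 x⁻¹), integrableOn_min_sq.const_mul (K * K'),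
      p ⁻¹' V ∩ q ⁻¹' V', inter_mem
        ((hp.differentiableAt (hU.mem_nhds hz)).continuousAt.preimage_mem_nhds hV)
        ((hq.differentiableAt (hU.mem_nhds hz)).continuousAt.preimage_mem_nhds hV'),
      (ae_restrict_iff' measurableSet_Ioi).2 (ae_of_all _ fun x hx w hw => ?_)⟩
    have hx0 : (0 : ℝ) < x := hx
    rw [norm_mul]
    calc _ ≤ (K * min 1 x⁻¹) * (K' * min 1 x⁻¹) := by
          gcongr
          · exact (h _ hw.1).2 x hx
          · exact (h' _ hw.2).2 x hx
      _ = _ := by ring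

/-- The explicit continuation of the autocorrelation to the slit plane. -/
noncomputable def autocorrExt (z : ℂ) : ℂ :=
  (z ^ (2⁻¹ : ℂ))⁻¹ * phi1Corr (z ^ (2⁻¹ : ℂ)) (z ^ (2⁻¹ : ℂ))⁻¹

theorem inv_re_pos {z : ℂ} (hz : 0 < z.re) : 0 < (z⁻¹).re := by
  rw [Complex.inv_re]
  exact div_pos hz (Complex.normSq_pos.2 (by rintro rfl; simp at hz))

theorem sqrt_re_pos {z : ℂ} (hz : z ∈ Complex.slitPlane) : 0 < (z ^ (2⁻¹ : ℂ)).re := by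
  have hz0 := Complex.slitPlane_ne_zero hz
  rw [Complex.cpow_def_of_ne_zero hz0, Complex.exp_re]
  refine mul_pos (Real.exp_pos _) (Real.cos_pos_of_mem_Ioo ?_)
  have h1 := Complex.neg_pi_lt_arg z
  have h2 := Complex.arg_le_pi z
  have h3 := (Complex.mem_slitPlane_iff_arg.1 hz).1
  have h4 : (Complex.log z * 2⁻¹).im = z.arg / 2 := by
    rw [show (2⁻¹ : ℂ) = ((2⁻¹ : ℝ) : ℂ) by simp, Complex.im_mul_ofReal, Complex.log_im]; rfl
  rw [h4]
  have h5 := lt_of_le_of_ne h2 h3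
  constructor <;> linarith

/-- The principal square root maps the slit plane into the right half-plane, which is stable under
inversion, so both arguments of the correlation remain admissible. -/
theorem differentiableOn_autocorrExt : DifferentiableOn ℂ autocorrExt Complex.slitPlane := by
  have h1 : DifferentiableOn ℂ (fun z : ℂ => z ^ (2⁻¹ : ℂ)) Complex.slitPlane := fun z hz =>
    (differentiableAt_id.cpow_const hz).differentiableWithinAt
  have h2 : DifferentiableOn ℂ (fun z : ℂ => (z ^ (2⁻¹ : ℂ))⁻¹) Complex.slitPlane :=
    h1.inv fun z hz h => by simpa [h] using sqrt_re_pos hz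
  exact h2.mul (differentiableOn_phi1Corr_comp Complex.isOpen_slitPlane h1 h2
    (fun z hz => sqrt_re_pos hz) fun z hz => inv_re_pos (sqrt_re_pos hz))

theorem autocorrExt_sq {w : ℂ} (hw : 0 < w.re) : autocorrExt (w ^ 2) = w⁻¹ * phi1Corr w w⁻¹ := by
  unfold autocorrExt
  rw [Complex.sq_cpow_two_inv hw]

theorem autocorr_eq (z : ℂ) : autocorr z = phi1Corr z 1 := by
  simp [autocorr, phi1Corr]

/-- For real y > 0, scaling by √y takes the pair (√y, 1/√y) to (y, 1); the identity theorem does the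
rest. -/
theorem isAutocorrContinuation_autocorrExt : IsAutocorrContinuation autocorrExt := by
  refine ⟨differentiableOn_autocorrExt, ?_⟩
  have hsub : {z : ℂ | 0 < z.re} ⊆ Complex.slitPlane := fun z hz =>
    Complex.mem_slitPlane_iff.2 (Or.inl hz)
  refine eqOn_of_eqOn_real isOpen_re_pos isPreconnected_re_pos
    (differentiableOn_autocorrExt.mono hsub) ?_ (x := 1) (by simp) ?_
  · rw [funext autocorr_eq]
    exact differentiableOn_phi1Corr_comp isOpen_re_pos differentiableOn_id
      (differentiableOn_const 1) (fun z hz => hz) (by simp)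
  · filter_upwards [lt_mem_nhds (zero_lt_one' ℝ)] with y hy
    have hs : 0 < √y := Real.sqrt_pos.2 hy
    have hs0 : ((√y : ℝ) : ℂ) ≠ 0 := by exact_mod_cast hs.ne'
    have h1 : (y : ℂ) = ((√y : ℝ) : ℂ) ^ 2 := by
      rw [← Complex.ofReal_pow, Real.sq_sqrt hy.le]
    rw [h1, autocorrExt_sq (by simpa using hs), autocorr_eq, ← h1]
    have h2 := phi1Corr_scale ((√y : ℝ) : ℂ) ((√y : ℝ) : ℂ)⁻¹ hs
    rw [mul_inv_cancel₀ hs0, ← sq, ← h1] at h2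
    exact h2.symm

theorem IsAutocorrContinuation.eqOn {A B : ℂ → ℂ} (hA : IsAutocorrContinuation A)
    (hB : IsAutocorrContinuation B) : EqOn A B Complex.slitPlane := by
  refine eqOn_of_eqOn_real Complex.isOpen_slitPlane
    (Complex.starConvex_one_slitPlane.isPathConnected Complex.one_mem_slitPlane).isConnected.isPreconnected
    hA.1 hB.1 (x := 1) (by simp) ?_
  filter_upwards [lt_mem_nhds (zero_lt_one' ℝ)] with y hy
  rw [hA.2 _ (by simpa using hy), hB.2 _ (by simpa using hy)]

/-! ### The Mellin transform of φ₁ in the critical strip -/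

/-- A chain of four convex pieces, glued at 1/2 + i, 1/2 - i and 3/2 + i. The puncture is the pole
of ζ. -/
theorem isPreconnected_re_pos_diff_one : IsPreconnected ({z : ℂ | 0 < z.re} \ {1}) := by
  have hU : {z : ℂ | 0 < z.re} \ {1} =
      ((({z : ℂ | 0 < z.re} ∩ {z | 0 < z.im}) ∪ ({z : ℂ | 0 < z.re} ∩ {z | z.re < 1})) ∪
        ({z : ℂ | 0 < z.re} ∩ {z | z.im < 0})) ∪ {z : ℂ | 1 < z.re} := by
    ext z
    simp only [Set.mem_sdiff, mem_ofPred_eq, mem_singleton_iff, mem_union, mem_inter_iff]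
    constructor
    · rintro ⟨h1, h2⟩
      have : z.re ≠ 1 ∨ z.im ≠ 0 := by
        by_contra! h
        exact h2 (Complex.ext h.1 h.2)
      rcases this with h | h <;> rcases lt_or_gt_of_ne h with h | h <;> tauto
    · rintro (((⟨h1, h2⟩ | ⟨h1, h2⟩) | ⟨h1, h2⟩) | h1) <;> refine ⟨by linarith, ?_⟩ <;> rintro rfl <;>
        simp at *
  have c0 := convex_halfSpace_re_gt 0
  rw [hU]
  refine IsPreconnected.union (1 / 2 + 1 + Complex.I) (Or.inl (Or.inl ?_)) (by norm_num) ?_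
    (convex_halfSpace_re_gt 1).isPreconnected
  · norm_num
  refine IsPreconnected.union (1 / 2 - Complex.I) (Or.inr ?_) (by norm_num) ?_
    (c0.inter (convex_halfSpace_im_lt 0)).isPreconnected
  · norm_num
  exact IsPreconnected.union (1 / 2 + Complex.I) (by norm_num) (by norm_num)
    (c0.inter (convex_halfSpace_im_gt 0)).isPreconnected
    (c0.inter (convex_halfSpace_re_lt 1)).isPreconnected

theorem exists_norm_phi1_le : ∃ K : ℝ, 0 < K ∧ ∀ x : ℝ, 0 < x → ‖phi1 x‖ ≤ K * min 1 x⁻¹ := by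
  obtain ⟨K, hK, V, hV, h⟩ := exists_norm_phi1_ray_le (z₀ := 1) (by simp)
  exact ⟨K, hK, fun x hx => by simpa using (h 1 (mem_of_mem_nhds hV)).2 x hx⟩

/-- `1/(e^t - 1)` with its polar part at `0` removed on `(0, 1]`. -/
noncomputable def truncBose (t : ℝ) : ℂ := phi1 t + (Ioi (1 : ℝ)).indicator (fun t => (t : ℂ)⁻¹) t

theorem exists_norm_truncBose_le : ∃ K : ℝ, ∀ x : ℝ, 0 < x → ‖truncBose x‖ ≤ K := by
  obtain ⟨K, hK, h⟩ := exists_norm_phi1_le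
  refine ⟨K + 1, fun x hx => (norm_add_le _ _).trans (add_le_add ?_ ?_)⟩
  · exact (h x hx).trans (mul_le_of_le_one_right hK.le (min_le_left _ _))
  · by_cases hx1 : x ∈ Ioi (1 : ℝ)
    · rw [indicator_of_mem hx1]
      have : 1 < x := hx1
      simpa [abs_of_pos hx] using inv_le_one_of_one_le₀ this.le
    · rw [indicator_of_notMem hx1]
      simp

theorem measurable_truncBose : Measurable truncBose := by
  refine Measurable.add (measurable_phi1.comp (by fun_prop)) (Measurable.indicator ?_ measurableSet_Ioi)
  fun_prop

theorem locallyIntegrableOn_truncBose : LocallyIntegrableOn truncBose (Ioi 0) := by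
  obtain ⟨K, hK⟩ := exists_norm_truncBose_le
  have h : LocallyIntegrableOn ((Ioi (0 : ℝ)).indicator truncBose) (Ioi 0) := by
    refine ((continuous_const (y := |K|)).locallyIntegrable.locallyIntegrableOn _).mono
      (measurable_truncBose.indicator measurableSet_Ioi).aestronglyMeasurable
      (ae_of_all _ fun x => ?_)
    by_cases hx : x ∈ Ioi (0 : ℝ)
    · rw [indicator_of_mem hx]
      simpa using (hK x hx).trans (le_abs_self K)
    · rw [indicator_of_notMem hx]
      simp
  exact h.congr (indicator_ae_eq_restrict measurableSet_Ioi)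

theorem truncBose_isBigO_top : truncBose =O[atTop] fun t : ℝ => Real.exp (-1 * t) := by
  refine Asymptotics.IsBigO.of_bound 2 ?_
  filter_upwards [eventually_gt_atTop 1] with t ht
  have h1 : truncBose t = 1 / (Complex.exp t - 1) := by
    unfold truncBose phi1
    rw [indicator_of_mem (by exact ht)]
    ring
  have h2 : Complex.exp t - 1 = ((Real.exp t - 1 : ℝ) : ℂ) := by push_cast; ring
  have h3 : 2 ≤ Real.exp t := by linarith [Real.add_one_le_exp t]
  rw [h1, h2, norm_div, norm_one, Complex.norm_real, Real.norm_of_nonneg (by linarith),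
    Real.norm_of_nonneg (by positivity), div_le_iff₀ (by linarith), neg_one_mul, Real.exp_neg]
  have : (Real.exp t)⁻¹ * Real.exp t = 1 := inv_mul_cancel₀ (Real.exp_ne_zero t)
  have h4 : (Real.exp t)⁻¹ ≤ 2⁻¹ := inv_anti₀ (by norm_num) h3
  nlinarith

/-- Boundedness, with exponent `-0` to fit the shape t^(-b) of the Mellin criterion. Taking b = 0
gives convergence on all of Re s > 0, which meets both the strip and the half-plane of the Dirichlet
series. -/
theorem truncBose_isBigO_zero : truncBose =O[𝓝[>] 0] fun t : ℝ => t ^ (-0 : ℝ) := by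
  obtain ⟨K, hK⟩ := exists_norm_truncBose_le
  refine Asymptotics.IsBigO.of_bound K ?_
  filter_upwards [self_mem_nhdsWithin] with t ht
  simpa using hK t ht

theorem mellinConvergent_truncBose {s : ℂ} (hs : 0 < s.re) : MellinConvergent truncBose s :=
  mellinConvergent_of_isBigO_rpow_exp one_pos locallyIntegrableOn_truncBose
    truncBose_isBigO_top truncBose_isBigO_zero hs

theorem differentiableAt_mellin_truncBose {s : ℂ} (hs : 0 < s.re) :
    DifferentiableAt ℂ (mellin truncBose) s :=
  mellin_differentiableAt_of_isBigO_rpow_exp one_pos locallyIntegrableOn_truncBose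
    truncBose_isBigO_top truncBose_isBigO_zero hs

theorem hasSum_exp_neg {t : ℝ} (ht : 0 < t) :
    HasSum (fun n : ℕ => (1 : ℂ) * Real.exp (-((n : ℝ) + 1) * t)) (1 / (Complex.exp t - 1)) := by
  have h0 : Real.exp (-t) < 1 := by simpa using ht
  have h := (hasSum_geometric_of_lt_one (Real.exp_pos (-t)).le h0).mul_left (Real.exp (-t))
  have h1 : Real.exp (-t) * (1 - Real.exp (-t))⁻¹ = 1 / (Real.exp t - 1) := by
    have : Real.exp t - 1 ≠ 0 := by
      have := Real.add_one_lt_exp ht.ne'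
      linarith
    rw [Real.exp_neg]
    have h2 := Real.exp_ne_zero t
    field_simp
  rw [h1] at h
  have h3 := Complex.hasSum_ofReal.2 h
  convert h3 using 1
  · ext n
    rw [one_mul, ← Real.exp_nat_mul, ← Real.exp_add]
    congr 2
    ring
  · push_cast; rfl

theorem mellin_bose {s : ℂ} (hs : 1 < s.re) :
    mellin (fun t : ℝ => 1 / (Complex.exp t - 1)) s = Complex.Gamma s * riemannZeta s := by
  have h := hasSum_mellin (a := fun _ : ℕ => (1 : ℂ)) (p := fun n : ℕ => (n : ℝ) + 1)
    (F := fun t : ℝ => 1 / (Complex.exp t - 1)) (s := s) (fun n => Or.inr (by positivity))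
    (by linarith) (fun t ht => hasSum_exp_neg ht) ?_
  · rw [← h.tsum_eq, zeta_eq_tsum_one_div_nat_add_one_cpow hs, ← tsum_mul_left]
    congr 1 with n
    push_cast
    ring
  · have := (Real.summable_one_div_nat_rpow.2 hs)
    simpa using (summable_nat_add_iff 1).2 this

/-- The subtracted part, 1/t on (0, 1], has Mellin transform 1/(s - 1) here. -/
theorem mellin_truncBose_of_one_lt {s : ℂ} (hs : 1 < s.re) :
    mellin truncBose s = Complex.Gamma s * riemannZeta s - 1 / (s - 1) := by
  have h1 := hasMellin_cpow_Ioc (-1) (s := s) (by simp; linarith)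
  have h2 := (hasMellin_add (mellinConvergent_truncBose (s := s) (by linarith)) h1.1).2
  rw [h1.2] at h2
  rw [eq_sub_iff_add_eq, ← mellin_bose hs, sub_eq_add_neg, ← h2]
  refine setIntegral_congr_fun measurableSet_Ioi fun t ht => ?_
  have ht0 : (0 : ℝ) < t := ht
  simp only [truncBose, phi1]
  congr 1
  rcases le_or_gt t 1 with h | h
  · rw [indicator_of_notMem (by simpa using h), indicator_of_mem (by exact ⟨ht0, h⟩), Complex.cpow_neg_one]
    ring
  · rw [indicator_of_mem (by exact h), indicator_of_notMem (by simp [h])]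
    ring

theorem mellin_truncBose {s : ℂ} (hs : 0 < s.re) (hs1 : s ≠ 1) :
    mellin truncBose s = Complex.Gamma s * riemannZeta s - 1 / (s - 1) := by
  have hU : IsOpen ({z : ℂ | 0 < z.re} \ {1}) := isOpen_re_pos.sdiff isClosed_singleton
  refine eqOn_of_eqOn_real hU isPreconnected_re_pos_diff_one (f := mellin truncBose)
    (g := fun s => Complex.Gamma s * riemannZeta s - 1 / (s - 1))
    (fun z hz => (differentiableAt_mellin_truncBose hz.1).differentiableWithinAt)
    (fun z hz => DifferentiableAt.differentiableWithinAt ?_) (x := 2) (by norm_num) ?_ ⟨hs, hs1⟩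
  · refine DifferentiableAt.sub (DifferentiableAt.mul (Complex.differentiableAt_Gamma _ ?_)
      (differentiableAt_riemannZeta hz.2)) ?_
    · rintro n rfl
      have := hz.1
      simp at this
      linarith [(Nat.cast_nonneg n : (0 : ℝ) ≤ n)]
    · exact DifferentiableAt.div (by fun_prop) (by fun_prop) (sub_ne_zero.2 hz.2)
  · filter_upwards [lt_mem_nhds (by norm_num : (1 : ℝ) < 2)] with y hy
    exact mellin_truncBose_of_one_lt (by simpa using hy)

/-- `Γ(s) ζ(s) = ∫₀^∞ (1/(e^x - 1) - 1/x) x^(s-1) dx` in the critical strip. -/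
theorem mellin_phi1 {s : ℂ} (h0 : 0 < s.re) (h1 : s.re < 1) :
    mellin (fun t : ℝ => phi1 t) s = Complex.Gamma s * riemannZeta s := by
  have hs1 : s ≠ 1 := by rintro rfl; simp at h1
  have hre : (s - 2).re < -1 := by simp; linarith
  have heq : ∀ t : ℝ, (t : ℂ) ^ (s - 1) • (Ioi (1 : ℝ)).indicator (fun t => (t : ℂ)⁻¹) t =
      (Ioi (1 : ℝ)).indicator (fun t => (t : ℂ) ^ (s - 2)) t := fun t => by
    by_cases ht : t ∈ Ioi (1 : ℝ)
    · have ht0 : (t : ℂ) ≠ 0 := by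
        have : (1 : ℝ) < t := ht
        exact_mod_cast (by linarith : t ≠ 0)
      rw [indicator_of_mem ht, indicator_of_mem ht, smul_eq_mul, ← Complex.cpow_neg_one,
        ← Complex.cpow_add _ _ ht0]
      congr 1; ring
    · rw [indicator_of_notMem ht, indicator_of_notMem ht, smul_zero]
  have hconv : MellinConvergent ((Ioi (1 : ℝ)).indicator (fun t => (t : ℂ)⁻¹)) s := by
    unfold MellinConvergent
    simp_rw [heq]
    exact ((integrable_indicator_iff measurableSet_Ioi).2
      (integrableOn_Ioi_cpow_of_lt hre one_pos)).integrableOn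
  -- For Re s < 1 the tail of 1/t on (1, ∞) contributes -1/(s - 1), so subtracting it cancels the
  -- polar term.
  have hval : mellin ((Ioi (1 : ℝ)).indicator (fun t => (t : ℂ)⁻¹)) s = -1 / (s - 1) := by
    unfold mellin
    simp_rw [heq]
    rw [setIntegral_indicator measurableSet_Ioi, Ioi_inter_Ioi, max_eq_right zero_le_one,
      integral_Ioi_cpow_of_lt hre one_pos]
    simp only [Complex.ofReal_one, Complex.one_cpow]
    congr 1; ring
  have h := (hasMellin_sub (mellinConvergent_truncBose h0) hconv).2
  rw [hval, mellin_truncBose h0 hs1] at h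
  rw [show Complex.Gamma s * riemannZeta s =
    Complex.Gamma s * riemannZeta s - 1 / (s - 1) - -1 / (s - 1) by ring, ← h]
  congr 1 with t
  simp [truncBose]

/-! ### Mellin transforms along rays and Mellin–Parseval -/

theorem norm_ofReal_cpow_sub_one (s : ℂ) {x : ℝ} (hx : 0 < x) :
    ‖(x : ℂ) ^ (s - 1)‖ = x ^ (s.re - 1) := by
  rw [Complex.norm_cpow_eq_rpow_re_of_pos hx]; simp

theorem mellinConvergent_phi1_ray {s z : ℂ} (h0 : 0 < s.re) (h1 : s.re < 1) (hz : 0 < z.re) :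
    MellinConvergent (fun t : ℝ => phi1 (t * z)) s := by
  obtain ⟨K, hK, V, hV, h⟩ := exists_norm_phi1_ray_le hz
  refine ((integrableOn_rpow_mul_min h0 h1).const_mul K).mono'
    (Measurable.aestronglyMeasurable ?_)
    ((ae_restrict_iff' measurableSet_Ioi).2 (ae_of_all _ fun x hx => ?_))
  · exact Measurable.smul (f := fun t : ℝ => (t : ℂ) ^ (s - 1)) (by fun_prop)
      (measurable_phi1_ray z)
  · have hx0 : (0 : ℝ) < x := hx
    rw [norm_smul, norm_ofReal_cpow_sub_one s hx0]
    calc _ ≤ x ^ (s.re - 1) * (K * min 1 x⁻¹) := by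
          gcongr
          exact (h z (mem_of_mem_nhds hV)).2 x hx
      _ = _ := by ring

/-- The Mellin transform of `φ₁` along a ray of the right half-plane. -/
theorem mellin_phi1_ray {s z : ℂ} (h0 : 0 < s.re) (h1 : s.re < 1) (hz : 0 < z.re) :
    mellin (fun t : ℝ => phi1 (t * z)) s = z ^ (-s) * (Complex.Gamma s * riemannZeta s) := by
  -- Both sides are holomorphic in z, and for z > 0 the identity is the scaling rule of the Mellin
  -- transform.
  refine eqOn_of_eqOn_real isOpen_re_pos isPreconnected_re_pos
    (f := fun z => mellin (fun t : ℝ => phi1 (t * z)) s)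
    (g := fun z => z ^ (-s) * (Complex.Gamma s * riemannZeta s)) ?_ ?_ (x := 1) (by simp) ?_ hz
  · unfold mellin
    refine differentiableOn_integral_of_dominated isOpen_re_pos
      (F := fun z (t : ℝ) => (t : ℂ) ^ (s - 1) • phi1 (t * z))
      (fun z hz => (mellinConvergent_phi1_ray h0 h1 hz).aestronglyMeasurable)
      ((ae_restrict_iff' measurableSet_Ioi).2 (ae_of_all _ fun x hx => ?_)) fun z hz => ?_
    · have hx0 : (0 : ℝ) < x := hx
      have : DifferentiableOn ℂ (fun z : ℂ => phi1 (x * z)) {z | 0 < z.re} :=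
        differentiableOn_phi1.comp (differentiableOn_id.const_mul _) fun z hz => by
          simpa using mul_pos hx0 hz
      exact this.const_smul ((x : ℂ) ^ (s - 1))
    · obtain ⟨K, hK, V, hV, h⟩ := exists_norm_phi1_ray_le hz
      refine ⟨fun x => K * (x ^ (s.re - 1) * min 1 x⁻¹),
        (integrableOn_rpow_mul_min h0 h1).const_mul K, V, hV,
        (ae_restrict_iff' measurableSet_Ioi).2 (ae_of_all _ fun x hx w hw => ?_)⟩
      have hx0 : (0 : ℝ) < x := hx
      rw [norm_smul, norm_ofReal_cpow_sub_one s hx0]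
      calc _ ≤ x ^ (s.re - 1) * (K * min 1 x⁻¹) := by
            gcongr
            exact (h w hw).2 x hx
        _ = _ := by ring
  · intro z hz
    exact ((differentiableAt_id.cpow_const
      (Complex.mem_slitPlane_iff.2 (Or.inl hz))).mul_const _).differentiableWithinAt
  · filter_upwards [lt_mem_nhds (zero_lt_one' ℝ)] with y hy
    rw [← mellin_phi1 h0 h1, ← smul_eq_mul, ← mellin_comp_mul_left _ _ hy]
    congr 1 with t
    push_cast
    rw [mul_comm]

/-- Rescaling u by x in the inner integral of the modulus separates it into two absolute Mellin
integrals, at s and at 1 - s, both in the strip. -/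
theorem integrable_mellin_phi1Corr_kernel {p q s : ℂ} (hp : 0 < p.re) (hq : 0 < q.re)
    (h0 : 0 < s.re) (h1 : s.re < 1) :
    Integrable (fun z : ℝ × ℝ => (z.2 : ℂ) ^ (s - 1) *
      (phi1 (z.1 * (z.2 * p)) * phi1 (z.1 * q)))
      ((volume.restrict (Ioi 0)).prod (volume.restrict (Ioi 0))) := by
  have hmeas : Measurable (fun z : ℝ × ℝ => (z.2 : ℂ) ^ (s - 1) *
      (phi1 (z.1 * (z.2 * p)) * phi1 (z.1 * q))) := by
    have h1 : Measurable fun z : ℝ × ℝ => phi1 (z.1 * (z.2 * p)) :=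
      measurable_phi1.comp (by fun_prop)
    have h2 : Measurable fun z : ℝ × ℝ => phi1 (z.1 * q) :=
      measurable_phi1.comp (by fun_prop)
    fun_prop
  refine (integrable_prod_iff hmeas.aestronglyMeasurable).2 ⟨?_, ?_⟩
  · refine (ae_restrict_iff' measurableSet_Ioi).2 (ae_of_all _ fun x hx => ?_)
    have h := (MellinConvergent.comp_mul_left hx).2 (mellinConvergent_phi1_ray h0 h1 hp)
    refine (Integrable.mul_const h (phi1 (x * q))).congr (ae_of_all _ fun u => ?_)
    simp only [smul_eq_mul]
    push_cast
    rw [mul_assoc, mul_assoc]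
  · have h1s : (1 - s).re = 1 - s.re := by simp
    have h := (mellinConvergent_phi1_ray (s := 1 - s) (z := q) (by rw [h1s]; linarith)
      (by rw [h1s]; linarith) hq).norm.const_mul (∫ u in Ioi (0 : ℝ), u ^ (s.re - 1) * ‖phi1 (u * p)‖)
    refine h.congr ((ae_restrict_iff' measurableSet_Ioi).2 (ae_of_all _ fun x hx => ?_))
    have hx0 : (0 : ℝ) < x := hx
    have hsc := integral_comp_mul_left_Ioi (fun u : ℝ => u ^ (s.re - 1) * ‖phi1 (u * p)‖) 0 hx0
    rw [mul_zero] at hsc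
    have hin : ∫ u in Ioi (0 : ℝ), ‖(u : ℂ) ^ (s - 1) * (phi1 (x * (u * p)) * phi1 (x * q))‖ =
        (x ^ (1 - s.re) * ‖phi1 (x * q)‖) *
          ∫ u in Ioi (0 : ℝ), (x * u) ^ (s.re - 1) * ‖phi1 ((x * u : ℝ) * p)‖ := by
      rw [← integral_const_mul]
      refine setIntegral_congr_fun measurableSet_Ioi fun u hu => ?_
      have hu0 : (0 : ℝ) < u := hu
      rw [norm_mul, norm_mul, norm_ofReal_cpow_sub_one s hu0, Real.mul_rpow hx0.le hu0.le,
        show 1 - s.re = -(s.re - 1) by ring, Real.rpow_neg hx0.le]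
      have := (Real.rpow_pos_of_pos hx0 (s.re - 1)).ne'
      push_cast
      rw [mul_assoc (x : ℂ)]
      field_simp
    simp only
    rw [hin, hsc, norm_smul, Complex.norm_cpow_eq_rpow_re_of_pos hx0, smul_eq_mul,
      ← Real.rpow_neg_one x, show (1 - s - 1).re = (1 - s.re) + -1 by simp; ring, Real.rpow_add hx0]
    ring

theorem mellinConvergent_phi1Corr {p q s : ℂ} (hp : 0 < p.re) (hq : 0 < q.re)
    (h0 : 0 < s.re) (h1 : s.re < 1) : MellinConvergent (fun u : ℝ => phi1Corr (u * p) q) s := by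
  have h := (integrable_mellin_phi1Corr_kernel hp hq h0 h1).integral_prod_right
  refine h.congr (ae_of_all _ fun u => ?_)
  simp only [phi1Corr, smul_eq_mul, integral_const_mul]

/-- Mellin–Parseval for the correlation of `φ₁` along two rays. -/
theorem mellin_phi1Corr {p q s : ℂ} (hp : 0 < p.re) (hq : 0 < q.re)
    (h0 : 0 < s.re) (h1 : s.re < 1) : mellin (fun u : ℝ => phi1Corr (u * p) q) s =
      mellin (fun t : ℝ => phi1 (t * p)) s * mellin (fun t : ℝ => phi1 (t * q)) (1 - s) := by
  have h := integral_integral_swap (μ := volume.restrict (Ioi (0 : ℝ)))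
    (ν := volume.restrict (Ioi (0 : ℝ))) (f := fun x u : ℝ => (u : ℂ) ^ (s - 1) *
      (phi1 (x * (u * p)) * phi1 (x * q))) (integrable_mellin_phi1Corr_kernel hp hq h0 h1)
  have hl : mellin (fun u : ℝ => phi1Corr (u * p) q) s = ∫ u in Ioi (0 : ℝ), ∫ x in Ioi (0 : ℝ),
      (u : ℂ) ^ (s - 1) * (phi1 (x * (u * p)) * phi1 (x * q)) := by
    simp only [mellin, phi1Corr, smul_eq_mul, integral_const_mul]
  rw [hl, ← h]
  conv_rhs => rw [mellin.eq_1 _ (1 - s), ← integral_const_mul]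
  refine setIntegral_congr_fun measurableSet_Ioi fun x hx => ?_
  have hm := mellin_comp_mul_left (fun t : ℝ => phi1 (t * p)) s (a := x) hx
  have hm' : ∫ u in Ioi (0 : ℝ), (u : ℂ) ^ (s - 1) * (phi1 (x * (u * p)) * phi1 (x * q)) =
      mellin (fun u : ℝ => phi1 ((x * u : ℝ) * p)) s * phi1 (x * q) := by
    rw [mellin, ← integral_mul_const]
    congr 1 with u
    push_cast
    rw [smul_eq_mul, mul_assoc (x : ℂ), mul_assoc]
  -- The factor x^(-s) from scaling is the Mellin weight at 1 - s.
  rw [hm', hm, show (1 - s - 1 : ℂ) = -s by ring]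
  simp only [smul_eq_mul]
  ring

theorem autocorrExt_ray {ω : ℂ} (hω : 0 < ω.re) {u : ℝ} (hu : 0 < u) :
    autocorrExt (u * (ω⁻¹) ^ 2) = ω * phi1Corr (u * ω⁻¹) ω := by
  have hs : 0 < √u := Real.sqrt_pos.2 hu
  have hs0 : ((√u : ℝ) : ℂ) ≠ 0 := by exact_mod_cast hs.ne'
  have hω0 : ω ≠ 0 := by rintro rfl; simp at hω
  have hsq : ((√u : ℝ) : ℂ) ^ 2 = u := by rw [← Complex.ofReal_pow, Real.sq_sqrt hu.le]
  have h1 : (u : ℂ) * (ω⁻¹) ^ 2 = (((√u : ℝ) : ℂ) * ω⁻¹) ^ 2 := by rw [mul_pow, hsq]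
  rw [h1, autocorrExt_sq (by simpa using mul_pos hs (inv_re_pos hω))]
  have h2 := phi1Corr_scale (((√u : ℝ) : ℂ) * ω⁻¹) (((√u : ℝ) : ℂ) * ω⁻¹)⁻¹ hs
  rw [← mul_assoc, ← sq, hsq, mul_inv, inv_inv, ← mul_assoc, mul_inv_cancel₀ hs0, one_mul] at h2
  rw [h2, mul_inv, inv_inv]
  field_simp

/-! ### The weight on the critical line and its decay -/

/-- The density of the twisted second moment of `ζ` on the critical line. -/
noncomputable def zetaWeight (δ t : ℝ) : ℝ :=
  ‖riemannZeta (1 / 2 + Complex.I * (t : ℂ))‖ ^ 2 *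
    (Real.exp ((Real.pi - δ) * t) / Real.cosh (Real.pi * t))

theorem zetaWeight_nonneg (δ t : ℝ) : 0 ≤ zetaWeight δ t := by
  have := Real.cosh_pos (Real.pi * t)
  unfold zetaWeight
  positivity

theorem continuous_zetaWeight (δ : ℝ) : Continuous (zetaWeight δ) := by
  have h : Continuous fun t : ℝ => riemannZeta (1 / 2 + Complex.I * (t : ℂ)) := by
    refine continuous_iff_continuousAt.2 fun t => ?_
    refine ContinuousAt.comp (g := riemannZeta) (differentiableAt_riemannZeta ?_).continuousAt
      (by fun_prop)
    intro h
    have := congrArg Complex.re h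
    norm_num at this
  unfold zetaWeight
  refine (h.norm.pow 2).mul (Continuous.div (by fun_prop) (by fun_prop) fun t =>
    (Real.cosh_pos _).ne')

theorem conj_critical (t : ℝ) : (starRingEnd ℂ) (1 / 2 + Complex.I * (t : ℂ)) =
    1 / 2 - Complex.I * t := by
  rw [map_add, map_mul, Complex.conj_I, Complex.conj_ofReal, map_div₀, map_one, map_ofNat]
  ring

theorem one_sub_critical (t : ℝ) : 1 - (1 / 2 + Complex.I * (t : ℂ)) =
    (starRingEnd ℂ) (1 / 2 + Complex.I * (t : ℂ)) := by
  rw [conj_critical]; ring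

theorem Gamma_critical_mul (t : ℝ) :
    Complex.Gamma (1 / 2 + Complex.I * (t : ℂ)) * Complex.Gamma (1 - (1 / 2 + Complex.I * (t : ℂ))) =
      ((Real.pi / Real.cosh (Real.pi * t) : ℝ) : ℂ) := by
  rw [Complex.Gamma_mul_Gamma_one_sub]
  push_cast
  congr 1
  rw [show (Real.pi : ℂ) * (1 / 2 + Complex.I * t) = (Real.pi * t) * Complex.I + Real.pi / 2 by ring,
    Complex.sin_add_pi_div_two, Complex.cos_mul_I]

/-- Euler's reflection formula gives π/cosh(πt), and since 1 - s is the conjugate of s, ζ(s)ζ(1-s) =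
|ζ(s)|². -/
theorem Gamma_mul_zeta_critical (t : ℝ) :
    (Complex.Gamma (1 / 2 + Complex.I * (t : ℂ)) * riemannZeta (1 / 2 + Complex.I * (t : ℂ))) *
      (Complex.Gamma (1 - (1 / 2 + Complex.I * (t : ℂ))) *
        riemannZeta (1 - (1 / 2 + Complex.I * (t : ℂ)))) =
      ((Real.pi * (‖riemannZeta (1 / 2 + Complex.I * (t : ℂ))‖ ^ 2 / Real.cosh (Real.pi * t)) : ℝ) : ℂ) := by
  rw [mul_mul_mul_comm, Gamma_critical_mul, one_sub_critical, riemannZeta_conj, Complex.mul_conj,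
    Complex.normSq_eq_norm_sq]
  push_cast
  ring

theorem norm_Gamma_mul_zeta_sq (t : ℝ) :
    ‖Complex.Gamma (1 / 2 + Complex.I * (t : ℂ)) * riemannZeta (1 / 2 + Complex.I * (t : ℂ))‖ ^ 2 =
      Real.pi * (‖riemannZeta (1 / 2 + Complex.I * (t : ℂ))‖ ^ 2 / Real.cosh (Real.pi * t)) := by
  have h := Gamma_mul_zeta_critical t
  rw [one_sub_critical, Complex.Gamma_conj, riemannZeta_conj, ← map_mul, Complex.mul_conj,
    Complex.normSq_eq_norm_sq] at h
  exact_mod_cast h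

theorem exp_I_re_pos {β : ℝ} (h : |β| < Real.pi / 2) : 0 < (Complex.exp (Complex.I * β)).re := by
  rw [mul_comm, Complex.exp_ofReal_mul_I_re]
  exact Real.cos_pos_of_mem_Ioo (abs_lt.1 h)

theorem exp_I_cpow {β : ℝ} (h : |β| < Real.pi / 2) (s : ℂ) :
    Complex.exp (Complex.I * β) ^ s = Complex.exp (Complex.I * β * s) := by
  have h' := abs_lt.1 h
  have hp := Real.pi_pos
  rw [Complex.cpow_def_of_ne_zero (Complex.exp_ne_zero _), Complex.log_exp]
  · simp; linarith
  · simp; linarith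

theorem critical_re (t : ℝ) : (1 / 2 + Complex.I * (t : ℂ)).re = 1 / 2 := by norm_num

/-- The Mellin transform along e^{iβ} has modulus e^{βt}|Γ(s)ζ(s)|, and its absolute integral does
not depend on t. No Stirling formula or growth bound for ζ enters. -/
theorem exists_norm_Gamma_mul_zeta_le {β : ℝ} (h : |β| < Real.pi / 2) : ∃ C : ℝ, ∀ t : ℝ,
    ‖Complex.Gamma (1 / 2 + Complex.I * (t : ℂ)) * riemannZeta (1 / 2 + Complex.I * (t : ℂ))‖ ≤
      C * Real.exp (-β * t) := by
  refine ⟨∫ u in Ioi (0 : ℝ), u ^ (1 / 2 - 1 : ℝ) * ‖phi1 (u * Complex.exp (Complex.I * β))‖,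
    fun t => ?_⟩
  set s : ℂ := 1 / 2 + Complex.I * (t : ℂ) with hs
  have hre : s.re = 1 / 2 := critical_re t
  have hm := mellin_phi1_ray (s := s) (by rw [hre]; norm_num) (by rw [hre]; norm_num)
    (exp_I_re_pos h)
  rw [exp_I_cpow h] at hm
  have hn : ‖Complex.exp (Complex.I * β * -s)‖ = Real.exp (β * t) := by
    rw [Complex.norm_exp]
    congr 1
    simp [hs]
  have hle : ‖mellin (fun t : ℝ => phi1 (t * Complex.exp (Complex.I * β))) s‖ ≤
      ∫ u in Ioi (0 : ℝ), u ^ (1 / 2 - 1 : ℝ) * ‖phi1 (u * Complex.exp (Complex.I * β))‖ := by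
    refine (norm_integral_le_integral_norm _).trans (le_of_eq ?_)
    refine setIntegral_congr_fun measurableSet_Ioi fun u hu => ?_
    simp only
    rw [norm_smul, norm_ofReal_cpow_sub_one s hu, hre]
  rw [hm, norm_mul, hn] at hle
  rw [neg_mul, Real.exp_neg, ← div_eq_mul_inv, le_div_iff₀ (Real.exp_pos _), mul_comm]
  exact hle

theorem exists_zetaWeight_le {δ : ℝ} (h0 : 0 < δ) (h1 : δ < Real.pi) :
    ∃ C : ℝ, 0 ≤ C ∧ ∀ t, zetaWeight δ t ≤ C * Real.exp (-(δ / 2) * |t|) := by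
  have hp := Real.pi_pos
  -- With 2β = π - δ/2 the exponent (π - δ)t - 2βt is exactly -(δ/2)t, as needed for t ≥ 0. The
  -- opposite β serves t ≤ 0.
  obtain ⟨C₁, h₁⟩ := exists_norm_Gamma_mul_zeta_le (β := (Real.pi / 2 - δ / 4))
    (abs_lt.2 ⟨by linarith, by linarith⟩)
  obtain ⟨C₂, h₂⟩ := exists_norm_Gamma_mul_zeta_le (β := -(Real.pi / 2 - δ / 4))
    (abs_lt.2 ⟨by linarith, by linarith⟩)
  have key : ∀ C β t : ℝ, ‖Complex.Gamma (1 / 2 + Complex.I * (t : ℂ)) *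
      riemannZeta (1 / 2 + Complex.I * (t : ℂ))‖ ≤ C * Real.exp (-β * t) →
      (Real.pi - δ) * t - 2 * β * t ≤ -(δ / 2) * |t| →
      zetaWeight δ t ≤ (C ^ 2 / Real.pi) * Real.exp (-(δ / 2) * |t|) := by
    intro C β t h hexp
    have h2 := pow_le_pow_left₀ (norm_nonneg _) h 2
    rw [norm_Gamma_mul_zeta_sq, mul_pow, ← Real.exp_nat_mul] at h2
    have h3 : zetaWeight δ t = (Real.pi * (‖riemannZeta (1 / 2 + Complex.I * (t : ℂ))‖ ^ 2 /
        Real.cosh (Real.pi * t))) * Real.exp ((Real.pi - δ) * t) / Real.pi := by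
      unfold zetaWeight
      field_simp
    rw [h3]
    calc _ ≤ (C ^ 2 * Real.exp ((2 : ℕ) * (-β * t))) * Real.exp ((Real.pi - δ) * t) / Real.pi := by
          gcongr
      _ = (C ^ 2 / Real.pi) * Real.exp ((Real.pi - δ) * t - 2 * β * t) := by
          rw [mul_assoc, ← Real.exp_add, mul_div_right_comm]
          congr 2
          push_cast
          ring
      _ ≤ _ := by gcongr
  refine ⟨C₁ ^ 2 / Real.pi + C₂ ^ 2 / Real.pi, by positivity, fun t => ?_⟩
  have hA : 0 ≤ C₁ ^ 2 / Real.pi * Real.exp (-(δ / 2) * |t|) := by positivity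
  have hB : 0 ≤ C₂ ^ 2 / Real.pi * Real.exp (-(δ / 2) * |t|) := by positivity
  rw [add_mul]
  rcases le_total 0 t with ht | ht
  · have := key C₁ _ t (h₁ t) (by rw [abs_of_nonneg ht]; nlinarith)
    linarith
  · have := key C₂ _ t (h₂ t) (by rw [abs_of_nonpos ht]; nlinarith)
    linarith

theorem integrable_exp_neg_mul_abs {c : ℝ} (hc : 0 < c) :
    Integrable fun t : ℝ => Real.exp (-c * |t|) := by
  rw [← integrableOn_univ, ← Iic_union_Ioi (a := (0 : ℝ))]
  refine IntegrableOn.union ?_ ?_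
  · refine (integrableOn_exp_mul_Iic hc 0).congr_fun (fun t ht => ?_) measurableSet_Iic
    simp only
    rw [abs_of_nonpos ht]
    ring_nf
  · refine (integrableOn_exp_mul_Ioi (neg_lt_zero.2 hc) 0).congr_fun (fun t ht => ?_)
      measurableSet_Ioi
    simp only
    rw [abs_of_pos ht]

theorem integrable_zetaWeight_pow {δ : ℝ} (h0 : 0 < δ) (h1 : δ < Real.pi) {k : ℕ} (hk : 1 ≤ k) :
    Integrable fun t => zetaWeight δ t ^ k := by
  obtain ⟨C, hC, h⟩ := exists_zetaWeight_le h0 h1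
  refine ((integrable_exp_neg_mul_abs (half_pos h0)).const_mul (C ^ k)).mono'
    ((continuous_zetaWeight δ).pow k).aestronglyMeasurable (ae_of_all _ fun t => ?_)
  rw [Real.norm_of_nonneg (pow_nonneg (zetaWeight_nonneg δ t) k)]
  refine (pow_le_pow_left₀ (zetaWeight_nonneg δ t) (h t) k).trans ?_
  rw [mul_pow]
  gcongr
  refine pow_le_of_le_one (Real.exp_pos _).le (Real.exp_le_one_iff.2 ?_) (by omega)
  rw [neg_mul]
  exact neg_nonpos.2 (by positivity)

theorem zetaWeight_pow (δ t : ℝ) (k : ℕ) : zetaWeight δ t ^ k =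
    ‖riemannZeta (1 / 2 + Complex.I * (t : ℂ))‖ ^ (2 * k) *
      (Real.exp (k * (Real.pi - δ) * t) / Real.cosh (Real.pi * t) ^ k) := by
  rw [zetaWeight, mul_pow, ← pow_mul, div_pow, ← Real.exp_nat_mul]
  ring_nf

/-! ### The continued autocorrelation on the ray -/

/-- The continued autocorrelation on the ray of direction `-e^{iδ}`. -/
noncomputable def rayCorr (δ u : ℝ) : ℂ := autocorrExt (-((u : ℂ) * Complex.exp (Complex.I * δ)))

theorem neg_mul_exp_mem_slitPlane {δ u : ℝ} (h0 : 0 < δ) (h1 : δ < Real.pi) (hu : 0 < u) :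
    -((u : ℂ) * Complex.exp (Complex.I * δ)) ∈ Complex.slitPlane := by
  refine Complex.mem_slitPlane_iff.2 (Or.inr ?_)
  have := Real.sin_pos_of_pos_of_lt_pi h0 h1
  rw [Complex.neg_im, Complex.im_ofReal_mul, mul_comm Complex.I,
    Complex.exp_ofReal_mul_I_im]
  exact neg_ne_zero.2 (mul_pos hu this).ne'

/-- Here -e^{iδ} = e^{i(δ-π)} is the square of ω⁻¹ with ω = e^{i(π-δ)/2}, and both ω and ω⁻¹ have
positive real part. -/
theorem rayCorr_eq {δ : ℝ} (h0 : 0 < δ) (h1 : δ < Real.pi) {u : ℝ} (hu : 0 < u) :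
    rayCorr δ u = Complex.exp (Complex.I * ((Real.pi - δ) / 2 : ℝ)) *
      phi1Corr (u * (Complex.exp (Complex.I * ((Real.pi - δ) / 2 : ℝ)))⁻¹)
        (Complex.exp (Complex.I * ((Real.pi - δ) / 2 : ℝ))) := by
  rw [← autocorrExt_ray (exp_I_re_pos (abs_lt.2 ⟨by linarith, by linarith⟩)) hu, rayCorr]
  congr 1
  rw [← mul_neg]
  congr 1
  rw [← Complex.exp_neg, ← Complex.exp_nat_mul]
  rw [show ((2 : ℕ) : ℂ) * -(Complex.I * ((Real.pi - δ) / 2 : ℝ)) =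
    Complex.I * δ - Real.pi * Complex.I by push_cast; ring, Complex.exp_sub, Complex.exp_pi_mul_I]
  rw [div_neg, div_one]

theorem mellinConvergent_rayCorr {δ : ℝ} (h0 : 0 < δ) (h1 : δ < Real.pi) {s : ℂ}
    (hs0 : 0 < s.re) (hs1 : s.re < 1) : MellinConvergent (rayCorr δ) s := by
  have hω := exp_I_re_pos (β := (Real.pi - δ) / 2) (abs_lt.2 ⟨by linarith, by linarith⟩)
  refine ((mellinConvergent_phi1Corr (inv_re_pos hω) hω hs0 hs1).const_smul
    (Complex.exp (Complex.I * ((Real.pi - δ) / 2 : ℝ)))).congr_fun (fun u hu => ?_) measurableSet_Ioi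
  rw [rayCorr_eq h0 h1 hu]
  rfl

theorem zetaWeight_neg (δ t : ℝ) : zetaWeight δ (-t) =
    ‖riemannZeta (1 / 2 + Complex.I * (t : ℂ))‖ ^ 2 / Real.cosh (Real.pi * t) *
      Real.exp (-(Real.pi - δ) * t) := by
  have h : ‖riemannZeta (1 / 2 + Complex.I * ((-t : ℝ) : ℂ))‖ =
      ‖riemannZeta (1 / 2 + Complex.I * (t : ℂ))‖ := by
    rw [← RCLike.norm_conj (riemannZeta (1 / 2 + Complex.I * (t : ℂ))), ← riemannZeta_conj,
      conj_critical]
    push_cast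
    ring_nf
  rw [zetaWeight, h, mul_neg, mul_neg, Real.cosh_neg, neg_mul]
  ring

theorem mellin_rayCorr {δ : ℝ} (h0 : 0 < δ) (h1 : δ < Real.pi) (t : ℝ) :
    mellin (rayCorr δ) (1 / 2 + Complex.I * t) =
      Complex.exp (Complex.I * ((Real.pi - δ) / 2 : ℝ)) * Real.pi * (zetaWeight δ (-t) : ℝ) := by
  set α : ℝ := (Real.pi - δ) / 2 with hα
  have hαl : |α| < Real.pi / 2 := abs_lt.2 ⟨by linarith, by linarith⟩
  have hαl' : |-α| < Real.pi / 2 := by rwa [abs_neg]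
  have hω := exp_I_re_pos hαl
  set s : ℂ := 1 / 2 + Complex.I * (t : ℂ) with hs
  have hre : s.re = 1 / 2 := critical_re t
  have hre' : (1 - s).re = 1 / 2 := by rw [Complex.sub_re, hre]; norm_num
  have e1 : mellin (rayCorr δ) s = Complex.exp (Complex.I * α) *
      mellin (fun u : ℝ => phi1Corr (u * (Complex.exp (Complex.I * α))⁻¹)
        (Complex.exp (Complex.I * α))) s := by
    rw [← smul_eq_mul, ← mellin_const_smul]
    refine setIntegral_congr_fun measurableSet_Ioi fun u hu => ?_
    simp only [smul_eq_mul]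
    rw [rayCorr_eq h0 h1 hu]
  have hinv : (Complex.exp (Complex.I * α))⁻¹ = Complex.exp (Complex.I * (-α : ℝ)) := by
    rw [← Complex.exp_neg]; push_cast; ring_nf
  rw [e1, mellin_phi1Corr (inv_re_pos hω) hω (by rw [hre]; norm_num) (by rw [hre]; norm_num),
    mellin_phi1_ray (by rw [hre]; norm_num) (by rw [hre]; norm_num) (inv_re_pos hω),
    mellin_phi1_ray (by rw [hre']; norm_num) (by rw [hre']; norm_num) hω, hinv,
    exp_I_cpow hαl', exp_I_cpow hαl, mul_mul_mul_comm, Gamma_mul_zeta_critical, zetaWeight_neg]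
  -- The two ray factors combine to ω^(2s-1) = ω^(2it) = e^{-(π-δ)t}; this sign is why the weight
  -- appears at -t.
  have hexp : Complex.exp (Complex.I * (-α : ℝ) * -s) * Complex.exp (Complex.I * α * -(1 - s)) =
      ((Real.exp (-(Real.pi - δ) * t) : ℝ) : ℂ) := by
    rw [← Complex.exp_add, Complex.ofReal_exp]
    congr 1
    rw [hs, hα]
    push_cast
    linear_combination (Real.pi - δ) * t * Complex.I_sq
  rw [hexp]
  push_cast
  ring

/-! ### The surface measure on u₁⋯u_k = 1 -/

/-- Lebesgue measure on the open positive orthant. -/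
noncomputable def orthantMeasure (n : ℕ) : Measure (Fin n → ℝ) :=
  (volume : Measure (Fin n → ℝ)).restrict {u | ∀ j, 0 < u j}

theorem measurableSet_orthant (n : ℕ) : MeasurableSet {u : Fin n → ℝ | ∀ j, 0 < u j} := by
  rw [Set.ofPred_forall]
  exact MeasurableSet.iInter fun j => measurableSet_lt measurable_const (measurable_pi_apply j)

theorem orthantMeasure_eq_pi (n : ℕ) :
    orthantMeasure n = Measure.pi fun _ : Fin n => (volume : Measure ℝ).restrict (Ioi 0) := by
  rw [← Measure.restrict_pi_pi, orthantMeasure]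
  congr 1
  ext u
  simp

theorem ae_orthant_pos (n : ℕ) : ∀ᵐ v ∂orthantMeasure n, ∀ j, 0 < v j :=
  ae_restrict_mem (measurableSet_orthant n)

instance (n : ℕ) : SigmaFinite (orthantMeasure n) := by
  unfold orthantMeasure; infer_instance

/-- The hypersurface `u₁ ⋯ u_{n+1} = 1` as a graph over its first `n` coordinates. -/
noncomputable def graphParam (n : ℕ) (v : Fin n → ℝ) : Fin (n + 1) → ℝ :=
  Fin.snoc (α := fun _ => ℝ) v (∏ j, v j)⁻¹

theorem surfaceParam_succ (n : ℕ) : surfaceParam (n + 1) = graphParam n := by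
  ext v i
  refine Fin.lastCases ?_ (fun j => ?_) i
  · simp [surfaceParam, graphParam]
  · simp [surfaceParam, graphParam]

theorem surfaceMeasure_succ (n : ℕ) : surfaceMeasure (n + 1) =
    ((orthantMeasure n).withDensity fun v => ENNReal.ofReal ((∏ j, v j)⁻¹)).map (graphParam n) := by
  rw [← surfaceParam_succ]
  rfl

theorem measurable_snoc {α : Type*} [MeasurableSpace α] {n : ℕ} {f : α → Fin n → ℝ} {g : α → ℝ}
    (hf : Measurable f) (hg : Measurable g) :
    Measurable fun a => (Fin.snoc (f a) (g a) : Fin (n + 1) → ℝ) := by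
  refine measurable_pi_iff.2 fun i => ?_
  refine Fin.lastCases ?_ (fun j => ?_) i
  · simpa using hg
  · simpa [Function.comp_def] using (measurable_pi_apply j).comp hf

theorem continuous_snoc {α : Type*} [TopologicalSpace α] {n : ℕ} {f : α → Fin n → ℝ} {g : α → ℝ}
    (hf : Continuous f) (hg : Continuous g) :
    Continuous fun a => (Fin.snoc (f a) (g a) : Fin (n + 1) → ℝ) := by
  refine continuous_pi fun i => ?_
  refine Fin.lastCases ?_ (fun j => ?_) i
  · simpa using hg
  · simpa [Function.comp_def] using (continuous_apply j).comp hf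

theorem measurable_prod_inv (n : ℕ) : Measurable fun v : Fin n → ℝ => (∏ j, v j)⁻¹ := by
  fun_prop

theorem measurable_graphParam (n : ℕ) : Measurable (graphParam n) :=
  measurable_snoc measurable_id (measurable_prod_inv n)

theorem measurableSet_hypersurface (k : ℕ) :
    MeasurableSet {u : Fin k → ℝ | (∀ j, 0 < u j) ∧ ∏ j, u j = 1} :=
  (measurableSet_orthant k).inter (measurableSet_eq_fun (by fun_prop) measurable_const)

theorem graphParam_mem {n : ℕ} {v : Fin n → ℝ} (hv : ∀ j, 0 < v j) :
    (∀ j, 0 < graphParam n v j) ∧ ∏ j, graphParam n v j = 1 := by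
  have hP : 0 < ∏ j, v j := Finset.prod_pos fun j _ => hv j
  unfold graphParam
  refine ⟨fun j => ?_, ?_⟩
  · refine Fin.lastCases ?_ (fun j => ?_) j
    · simpa using hP
    · simpa using hv j
  · rw [Fin.prod_univ_castSucc]
    simp [hP.ne']

theorem ae_surfaceMeasure (n : ℕ) : ∀ᵐ u ∂surfaceMeasure (n + 1), (∀ j, 0 < u j) ∧ ∏ j, u j = 1 := by
  rw [surfaceMeasure_succ]
  refine (ae_map_iff (measurable_graphParam n).aemeasurable (measurableSet_hypersurface _)).2 ?_
  refine (withDensity_absolutelyContinuous _ _).ae_le ?_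
  filter_upwards [ae_orthant_pos n] with v hv using graphParam_mem hv

theorem surfaceMeasure_density_lt_top (n : ℕ) :
    ∀ᵐ v ∂orthantMeasure n, ENNReal.ofReal ((∏ j, v j)⁻¹) < ⊤ :=
  ae_of_all _ fun _ => ENNReal.ofReal_lt_top

theorem toReal_density {n : ℕ} {v : Fin n → ℝ} (hv : ∀ j, 0 < v j) :
    (ENNReal.ofReal ((∏ j, v j)⁻¹)).toReal = (∏ j, v j)⁻¹ :=
  ENNReal.toReal_ofReal (inv_nonneg.2 (Finset.prod_nonneg fun j _ => (hv j).le))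

theorem integrable_surfaceMeasure_iff {E : Type*} [NormedAddCommGroup E] [NormedSpace ℝ E] {n : ℕ}
    {G : (Fin (n + 1) → ℝ) → E} (hG : AEStronglyMeasurable G (surfaceMeasure (n + 1))) :
    Integrable G (surfaceMeasure (n + 1)) ↔
      Integrable (fun v : Fin n → ℝ => (∏ j, v j)⁻¹ • G (Fin.snoc v (∏ j, v j)⁻¹))
        (orthantMeasure n) := by
  rw [surfaceMeasure_succ] at hG ⊢
  rw [integrable_map_measure hG (measurable_graphParam n).aemeasurable,
    integrable_withDensity_iff_integrable_smul' (by fun_prop) (surfaceMeasure_density_lt_top n)]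
  refine integrable_congr ?_
  filter_upwards [ae_orthant_pos n] with v hv
  rw [toReal_density hv, Function.comp_apply, graphParam]

theorem integral_surfaceMeasure {E : Type*} [NormedAddCommGroup E] [NormedSpace ℝ E] {n : ℕ}
    {G : (Fin (n + 1) → ℝ) → E} (hG : AEStronglyMeasurable G (surfaceMeasure (n + 1))) :
    ∫ u, G u ∂surfaceMeasure (n + 1) =
      ∫ v, (∏ j, v j)⁻¹ • G (Fin.snoc v (∏ j, v j)⁻¹) ∂orthantMeasure n := by
  rw [surfaceMeasure_succ] at hG ⊢
  rw [integral_map (measurable_graphParam n).aemeasurable hG,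
    integral_withDensity_eq_integral_toReal_smul (by fun_prop) (surfaceMeasure_density_lt_top n)]
  refine integral_congr_ae ?_
  filter_upwards [ae_orthant_pos n] with v hv
  rw [toReal_density hv, graphParam]

theorem orthantMeasure_box_lt_top (n : ℕ) (R : ℝ) :
    orthantMeasure n (univ.pi fun _ => Iic R) < ⊤ := by
  rw [orthantMeasure_eq_pi, Measure.pi_pi]
  refine ENNReal.prod_lt_top fun j _ => ?_
  rw [Measure.restrict_apply measurableSet_Iic, Iic_inter_Ioi, Real.volume_Ioc]
  exact ENNReal.ofReal_lt_top

/-- The density equals the last coordinate of the graph, so it is bounded on balls, while the other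
coordinates stay in a bounded box. -/
theorem isLocallyFiniteMeasure_surfaceMeasure (n : ℕ) :
    IsLocallyFiniteMeasure (surfaceMeasure (n + 1)) := by
  refine ⟨fun x => ⟨Metric.ball x 1, Metric.ball_mem_nhds x one_pos, ?_⟩⟩
  set R := ‖x‖ + 1
  have hball : ∀ u ∈ Metric.ball x 1, ∀ i, u i ≤ R := fun u hu i => by
    have h1 : ‖u - x‖ < 1 := by rwa [mem_ball_iff_norm] at hu
    have h2 := norm_le_pi_norm u i
    have h3 := norm_le_norm_add_norm_sub' u x
    linarith [le_abs_self (u i), Real.norm_eq_abs (u i)]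
  have hT : MeasurableSet (graphParam n ⁻¹' Metric.ball x 1) :=
    measurable_graphParam n Metric.isOpen_ball.measurableSet
  rw [surfaceMeasure_succ, Measure.map_apply (measurable_graphParam n)
    Metric.isOpen_ball.measurableSet, withDensity_apply _ hT]
  calc _ ≤ ∫⁻ v in graphParam n ⁻¹' Metric.ball x 1, ENNReal.ofReal R ∂orthantMeasure n := by
        refine setLIntegral_mono measurable_const fun v hv => ENNReal.ofReal_le_ofReal ?_
        have := hball _ hv (Fin.last n)
        simpa [graphParam] using this
    _ = ENNReal.ofReal R * orthantMeasure n (graphParam n ⁻¹' Metric.ball x 1) := by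
        rw [setLIntegral_const]
    _ ≤ ENNReal.ofReal R * orthantMeasure n (univ.pi fun _ => Iic R) := by
        gcongr
        intro v hv j _
        have := hball _ hv j.castSucc
        simpa [graphParam] using this
    _ < ⊤ := ENNReal.mul_lt_top ENNReal.ofReal_lt_top (orthantMeasure_box_lt_top n R)

theorem surfaceMeasure_one : surfaceMeasure 1 = Measure.dirac (fun _ => 1) := by
  rw [surfaceMeasure_succ 0, orthantMeasure_eq_pi, Measure.pi_of_empty]
  have h1 : (fun v : Fin 0 → ℝ => ENNReal.ofReal ((∏ j, v j)⁻¹)) = 1 := by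
    ext v; simp
  rw [h1, withDensity_one, Measure.map_dirac' (measurable_graphParam 0)]
  congr 1
  ext i
  obtain rfl : i = Fin.last 0 := Fin.fin_one_eq_zero i
  simp [graphParam, Fin.snoc]

/-- Integration over a slab `1 ≤ u₁ ⋯ u_{n+1} ≤ 1 + ε` in the coordinates given by the first `n`
variables and the rescaled product. -/
theorem setIntegral_slab (n : ℕ) {g : (Fin (n + 1) → ℝ) → ℝ} (hg : Continuous g)
    (hc : HasCompactSupport g) {ε : ℝ} (hε : 0 < ε) :
    ε⁻¹ * ∫ u in {u : Fin (n + 1) → ℝ | (∀ j, 0 < u j) ∧ 1 ≤ ∏ j, u j ∧ ∏ j, u j ≤ 1 + ε}, g u =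
      ∫ v, ((∏ j, v j)⁻¹ * ∫ τ in (0 : ℝ)..1,
        g (Fin.snoc v ((∏ j, v j)⁻¹ + ε * (∏ j, v j)⁻¹ * τ))) ∂orthantMeasure n := by
  set S : Set (Fin (n + 1) → ℝ) :=
    {u | (∀ j, 0 < u j) ∧ 1 ≤ ∏ j, u j ∧ ∏ j, u j ≤ 1 + ε} with hS
  have hSm : MeasurableSet S :=
    (measurableSet_orthant _).inter ((measurableSet_le (f := fun _ => (1 : ℝ)) (g := fun u : Fin (n + 1) → ℝ => ∏ j, u j)
      measurable_const (by fun_prop)).inter (measurableSet_le (f := fun u : Fin (n + 1) → ℝ => ∏ j, u j)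
      (g := fun _ => 1 + ε) (by fun_prop) measurable_const))
  have hint : Integrable (S.indicator g) := (hg.integrable_of_hasCompactSupport hc).indicator hSm
  have hmp := (volume_preserving_piFinSuccAbove (fun _ : Fin (n + 1) => ℝ) (Fin.last n)).symm
  have hsymm : ∀ p : ℝ × (Fin n → ℝ), (MeasurableEquiv.piFinSuccAbove (fun _ : Fin (n + 1) => ℝ)
      (Fin.last n)).symm p = (Fin.snoc p.2 p.1 : Fin (n + 1) → ℝ) := fun p => by
    simp [MeasurableEquiv.piFinSuccAbove, Fin.insertNthEquiv]
  have hint' : Integrable fun p : ℝ × (Fin n → ℝ) => S.indicator g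
      ((MeasurableEquiv.piFinSuccAbove (fun _ : Fin (n + 1) => ℝ) (Fin.last n)).symm p) :=
    (hmp.integrable_comp_emb (MeasurableEquiv.measurableEmbedding _)).2 hint
  rw [← integral_indicator hSm, ← hmp.integral_comp' (g := S.indicator g)]
  rw [Measure.volume_eq_prod, integral_prod_symm _ hint', ← integral_const_mul, orthantMeasure,
    ← integral_indicator (measurableSet_orthant n)]
  congr 1 with v
  simp only [hsymm]
  by_cases hv : ∀ j, 0 < v j
  · rw [indicator_of_mem (by exact hv)]
    have hP : 0 < ∏ j, v j := Finset.prod_pos fun j _ => hv j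
    set P := ∏ j, v j
    have hmem : ∀ y : ℝ, (Fin.snoc v y : Fin (n + 1) → ℝ) ∈ S ↔
        y ∈ Icc P⁻¹ (P⁻¹ + ε * P⁻¹) := fun y => by
      rw [hS, mem_ofPred_eq, Fin.prod_univ_castSucc, Fin.forall_fin_succ']
      simp only [Fin.snoc_castSucc, Fin.snoc_last]
      have e1 : P⁻¹ + ε * P⁻¹ = (1 + ε) / P := by field_simp
      rw [e1, mem_Icc, le_div_iff₀ hP, inv_le_iff_one_le_mul₀ hP, mul_comm y]
      constructor
      · rintro ⟨_, h⟩; exact h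
      · intro h
        exact ⟨⟨hv, (mul_pos_iff_of_pos_left hP).1 (by linarith [h.1])⟩, h⟩
    have h1 : (fun y : ℝ => S.indicator g (Fin.snoc v y : Fin (n + 1) → ℝ)) =
        (Icc P⁻¹ (P⁻¹ + ε * P⁻¹)).indicator fun y => g (Fin.snoc v y : Fin (n + 1) → ℝ) := by
      ext y
      by_cases hy : y ∈ Icc P⁻¹ (P⁻¹ + ε * P⁻¹)
      · rw [indicator_of_mem hy, indicator_of_mem ((hmem y).2 hy)]
      · rw [indicator_of_notMem hy, indicator_of_notMem (mt (hmem y).1 hy)]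
    have hle : P⁻¹ ≤ P⁻¹ + ε * P⁻¹ := by
      have : 0 < ε * P⁻¹ := by positivity
      linarith
    -- The Jacobian of y = P⁻¹ + εP⁻¹τ is εP⁻¹: ε cancels the normalization and P⁻¹ is the density.
    have h2 := intervalIntegral.integral_comp_add_mul
      (fun y : ℝ => g (Fin.snoc v y : Fin (n + 1) → ℝ)) (a := 0) (b := 1) (c := ε * P⁻¹)
      (by positivity) P⁻¹
    rw [h1, integral_indicator measurableSet_Icc, integral_Icc_eq_integral_Ioc,
      ← intervalIntegral.integral_of_le hle, h2, mul_zero, mul_one, add_zero, smul_eq_mul]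
    field_simp
  · rw [indicator_of_notMem (by exact hv)]
    have : ∀ y : ℝ, S.indicator g (Fin.snoc v y : Fin (n + 1) → ℝ) = 0 := fun y => by
      refine indicator_of_notMem (fun h => hv fun j => ?_) _
      simpa using h.1 j.castSucc
    simp [this]

theorem tendsto_slab (n : ℕ) {g : (Fin (n + 1) → ℝ) → ℝ} (hg : Continuous g)
    (hc : HasCompactSupport g) :
    Tendsto (fun ε : ℝ => ε⁻¹ *
      ∫ u in {u : Fin (n + 1) → ℝ | (∀ j, 0 < u j) ∧ 1 ≤ ∏ j, u j ∧ ∏ j, u j ≤ 1 + ε}, g u)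
      (𝓝[>] 0) (𝓝 (∫ u, g u ∂surfaceMeasure (n + 1))) := by
  obtain ⟨M, hM⟩ := hc.exists_bound_of_continuous hg
  obtain ⟨R, hR0, hR⟩ := hc.isCompact.isBounded.exists_pos_norm_le
  have hM0 : 0 ≤ M := (norm_nonneg _).trans (hM 0)
  have hzero : ∀ u i, R < u i → g u = 0 := fun u i hi => by
    by_contra h
    have h1 := hR u (subset_closure h)
    have h2 := norm_le_pi_norm u i
    linarith [le_abs_self (u i), Real.norm_eq_abs (u i)]
  rw [integral_surfaceMeasure hg.aestronglyMeasurable]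
  refine (tendsto_congr' (f₂ := fun ε : ℝ => ∫ v, ((∏ j, v j)⁻¹ * ∫ τ in (0 : ℝ)..1,
    g (Fin.snoc v ((∏ j, v j)⁻¹ + ε * (∏ j, v j)⁻¹ * τ))) ∂orthantMeasure n) ?_).2 ?_
  · filter_upwards [self_mem_nhdsWithin] with ε hε using setIntegral_slab n hg hc hε
  -- Since g vanishes once a coordinate exceeds R, only v in the box with P⁻¹ ≤ R contribute, and
  -- there the integrand is at most RM.
  refine tendsto_integral_filter_of_dominated_convergence
    ((univ.pi fun _ => Iic R).indicator fun _ => R * M) ?_ ?_ ?_ ?_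
  · refine Eventually.of_forall fun ε => ?_
    refine (measurable_prod_inv n).aestronglyMeasurable.mul ?_
    simp only [intervalIntegral.integral_of_le zero_le_one]
    refine (StronglyMeasurable.integral_prod_right (f := fun (v : Fin n → ℝ) (τ : ℝ) =>
      g (Fin.snoc v ((∏ j, v j)⁻¹ + ε * (∏ j, v j)⁻¹ * τ))) ?_).aestronglyMeasurable
    refine (hg.measurable.comp (measurable_snoc measurable_fst ?_)).stronglyMeasurable
    fun_prop
  · filter_upwards [self_mem_nhdsWithin] with ε hε
    have hε0 : (0 : ℝ) < ε := hε
    filter_upwards [ae_orthant_pos n] with v hv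
    have hP : 0 < ∏ j, v j := Finset.prod_pos fun j _ => hv j
    set P := ∏ j, v j
    by_cases hbox : v ∈ univ.pi fun _ => Iic R
    · rw [indicator_of_mem hbox, norm_mul, Real.norm_of_nonneg (inv_pos.2 hP).le]
      by_cases hPR : P⁻¹ ≤ R
      · have h1 := intervalIntegral.norm_integral_le_of_norm_le_const (a := (0 : ℝ)) (b := 1)
          (f := fun τ => g (Fin.snoc v (P⁻¹ + ε * P⁻¹ * τ) : Fin (n + 1) → ℝ)) (C := M)
          fun τ _ => hM _
        rw [sub_zero, abs_one, mul_one] at h1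
        gcongr
      · have h1 : ∫ τ in (0 : ℝ)..1, g (Fin.snoc v (P⁻¹ + ε * P⁻¹ * τ) : Fin (n + 1) → ℝ) = 0 := by
          rw [intervalIntegral.integral_of_le zero_le_one]
          refine setIntegral_eq_zero_of_forall_eq_zero fun τ hτ => hzero _ (Fin.last n) ?_
          rw [Fin.snoc_last]
          have : 0 ≤ ε * P⁻¹ * τ := by
            have := hτ.1
            positivity
          linarith [not_le.1 hPR]
        rw [h1]
        simp
        positivity
    · rw [indicator_of_notMem hbox]
      simp only [mem_univ_pi, mem_Iic, not_forall, not_le] at hbox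
      obtain ⟨j, hj⟩ := hbox
      have h1 : ∀ y : ℝ, g (Fin.snoc v y : Fin (n + 1) → ℝ) = 0 := fun y =>
        hzero _ j.castSucc (by simpa using hj)
      simp [h1]
  · refine (integrable_indicator_iff (MeasurableSet.univ_pi fun _ => measurableSet_Iic)).2 ?_
    exact integrableOn_const (orthantMeasure_box_lt_top n R).ne
  · refine ae_of_all _ fun v => ?_
    refine (Tendsto.const_mul _ ?_).mono_left nhdsWithin_le_nhds
    have hcont : Continuous fun ε : ℝ => ∫ τ in (0 : ℝ)..1,
        g (Fin.snoc v ((∏ j, v j)⁻¹ + ε * (∏ j, v j)⁻¹ * τ)) := by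
      refine intervalIntegral.continuous_parametric_intervalIntegral_of_continuous' ?_ 0 1
      exact hg.comp (continuous_snoc continuous_const (by fun_prop))
    simpa using hcont.tendsto 0

/-! ### Mellin inversion, Fubini and the moment formula -/

theorem rayCorr_continuousOn {δ : ℝ} (h0 : 0 < δ) (h1 : δ < Real.pi) :
    ContinuousOn (rayCorr δ) (Ioi 0) := by
  refine (differentiableOn_autocorrExt.continuousOn).comp (by fun_prop) fun u hu =>
    neg_mul_exp_mem_slitPlane h0 h1 hu

/-- Mellin inversion for the continued autocorrelation along a ray. -/
theorem integral_cpow_mul_mellin_rayCorr {δ : ℝ} (h0 : 0 < δ) (h1 : δ < Real.pi) {u : ℝ}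
    (hu : 0 < u) : ∫ t : ℝ, (u : ℂ) ^ (-(1 / 2 + Complex.I * (t : ℂ))) *
      (Complex.exp (Complex.I * ((Real.pi - δ) / 2 : ℝ)) * Real.pi * (zetaWeight δ (-t) : ℝ)) =
      2 * Real.pi * rayCorr δ u := by
  have hs : ∀ t : ℝ, (((1 / 2 : ℝ) : ℂ) + t * Complex.I) = 1 / 2 + Complex.I * t := fun t => by
    push_cast; ring
  have hw : Integrable fun t => zetaWeight δ t := by
    simpa using integrable_zetaWeight_pow h0 h1 le_rfl
  have h := mellinInv_mellin_eq (1 / 2) (rayCorr δ) hu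
    (mellinConvergent_rayCorr h0 h1 (by simp) (by norm_num))
    (by
      unfold Complex.VerticalIntegrable
      simp_rw [hs, mellin_rayCorr h0 h1]
      exact (hw.comp_neg.ofReal).const_mul _)
    ((rayCorr_continuousOn h0 h1).continuousAt (Ioi_mem_nhds hu))
  unfold mellinInv at h
  simp_rw [hs, mellin_rayCorr h0 h1, smul_eq_mul] at h
  have hpi : (2 * Real.pi : ℂ) * ((1 / (2 * Real.pi) : ℝ) : ℂ) = 1 := by
    have := Complex.ofReal_ne_zero.2 Real.pi_ne_zero
    push_cast
    field_simp
  rw [← h, Complex.real_smul, ← mul_assoc, hpi, one_mul]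

/-- `rayCorr` extended by zero to a measurable function on the line. -/
noncomputable def rayCorrPos (δ : ℝ) : ℝ → ℂ := (Ioi (0 : ℝ)).indicator (rayCorr δ)

theorem rayCorrPos_of_pos (δ : ℝ) {u : ℝ} (hu : 0 < u) : rayCorrPos δ u = rayCorr δ u :=
  indicator_of_mem hu _

theorem measurable_rayCorrPos {δ : ℝ} (h0 : 0 < δ) (h1 : δ < Real.pi) :
    Measurable (rayCorrPos δ) := by
  classical
  unfold rayCorrPos
  rw [← piecewise_eq_indicator]
  exact (rayCorr_continuousOn h0 h1).measurable_piecewise continuousOn_const measurableSet_Ioi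

/-- On the critical line |v^(s-1)| = v^(-1/2) is independent of t, so the modulus is that of a
product of a function of v and a function of t. -/
theorem integrable_moment_kernel {δ : ℝ} (h0 : 0 < δ) (h1 : δ < Real.pi) (n : ℕ) :
    Integrable (fun z : (Fin n → ℝ) × ℝ =>
      (∏ j, (z.1 j : ℂ) ^ (1 / 2 + Complex.I * (z.2 : ℂ) - 1) * rayCorrPos δ (z.1 j)) *
      (Complex.exp (Complex.I * ((Real.pi - δ) / 2 : ℝ)) * Real.pi * (zetaWeight δ (-z.2) : ℝ)))
      ((orthantMeasure n).prod volume) := by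
  have hB := measurable_rayCorrPos h0 h1
  have hw : Integrable fun t => zetaWeight δ t := by
    simpa using integrable_zetaWeight_pow h0 h1 le_rfl
  have h₁ : Integrable (fun v : Fin n → ℝ =>
      ∏ j, (v j : ℂ) ^ ((1 / 2 : ℂ) - 1) * rayCorrPos δ (v j)) (orthantMeasure n) := by
    rw [orthantMeasure_eq_pi]
    refine Integrable.fintype_prod (f := fun _ (x : ℝ) =>
      (x : ℂ) ^ ((1 / 2 : ℂ) - 1) * rayCorrPos δ x) fun _ => ?_
    refine (mellinConvergent_rayCorr (s := 1 / 2) h0 h1 (by norm_num) (by norm_num)).congr_fun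
      (fun u hu => ?_) measurableSet_Ioi
    rw [rayCorrPos_of_pos δ hu]
    rfl
  have h₂ : Integrable fun t : ℝ =>
      Complex.exp (Complex.I * ((Real.pi - δ) / 2 : ℝ)) * Real.pi * (zetaWeight δ (-t) : ℝ) :=
    (hw.comp_neg.ofReal).const_mul _
  refine (h₁.mul_prod h₂).mono (Measurable.aestronglyMeasurable ?_) ?_
  · have := (continuous_zetaWeight δ).measurable
    have hB' : ∀ j, Measurable fun z : (Fin n → ℝ) × ℝ => rayCorrPos δ (z.1 j) := fun j =>
      hB.comp (by fun_prop)
    fun_prop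
  · have hae : ∀ᵐ z ∂(orthantMeasure n).prod (volume : Measure ℝ), ∀ j, 0 < z.1 j :=
      Measure.quasiMeasurePreserving_fst.ae (ae_orthant_pos n)
    filter_upwards [hae] with z hz
    simp only [norm_mul, norm_prod]
    refine le_of_eq ?_
    congr 1
    refine Finset.prod_congr rfl fun j _ => ?_
    rw [norm_ofReal_cpow_sub_one _ (hz j), norm_ofReal_cpow_sub_one _ (hz j),
      critical_re]
    norm_num

theorem prod_ofReal_cpow {ι : Type*} (s : Finset ι) {v : ι → ℝ} (hv : ∀ i, 0 ≤ v i) (c : ℂ) :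
    ∏ i ∈ s, (v i : ℂ) ^ c = ((∏ i ∈ s, v i : ℝ) : ℂ) ^ c := by
  classical
  induction s using Finset.induction_on with
  | empty => simp
  | insert a s ha ih =>
    rw [Finset.prod_insert ha, Finset.prod_insert ha, ih, Complex.ofReal_mul,
      Complex.mul_cpow_ofReal_nonneg (hv a) (Finset.prod_nonneg fun i _ => hv i)]

/-- The inner integral over the critical line of the moment kernel. -/
theorem integral_moment_kernel_right {δ : ℝ} (h0 : 0 < δ) (h1 : δ < Real.pi) {n : ℕ}
    {v : Fin n → ℝ} (hv : ∀ j, 0 < v j) :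
    ∫ t : ℝ, (∏ j, (v j : ℂ) ^ (1 / 2 + Complex.I * (t : ℂ) - 1) * rayCorrPos δ (v j)) *
      (Complex.exp (Complex.I * ((Real.pi - δ) / 2 : ℝ)) * Real.pi * (zetaWeight δ (-t) : ℝ)) =
    2 * Real.pi * ((∏ j, v j)⁻¹ •
      ∏ i, rayCorrPos δ ((Fin.snoc v (∏ j, v j)⁻¹ : Fin (n + 1) → ℝ) i)) := by
  have hP : 0 < ∏ j, v j := Finset.prod_pos fun j _ => hv j
  -- With P = ∏ v_j, the density P⁻¹ times the inversion factor (P⁻¹)^(-s) is P^(s-1), which splits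
  -- over the coordinates.
  have key : ∀ t : ℝ, (∏ j, (v j : ℂ) ^ (1 / 2 + Complex.I * (t : ℂ) - 1) * rayCorrPos δ (v j)) =
      (((∏ j, v j)⁻¹ : ℝ) : ℂ) * (∏ j, rayCorrPos δ (v j)) *
        (((∏ j, v j)⁻¹ : ℝ) : ℂ) ^ (-(1 / 2 + Complex.I * (t : ℂ))) := fun t => by
    have hP0 : ((∏ j, v j : ℝ) : ℂ) ≠ 0 := Complex.ofReal_ne_zero.2 hP.ne'
    have hpow : ∏ j, (v j : ℂ) ^ (1 / 2 + Complex.I * (t : ℂ) - 1) =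
        ((∏ j, v j : ℝ) : ℂ) ^ (1 / 2 + Complex.I * (t : ℂ) - 1) :=
      prod_ofReal_cpow _ (fun j => (hv j).le) _
    rw [Finset.prod_mul_distrib, hpow, Complex.cpow_sub _ _ hP0, Complex.cpow_one,
      Complex.ofReal_inv, Complex.inv_cpow _ _ ?_, Complex.cpow_neg, inv_inv]
    · ring
    · rw [Complex.arg_ofReal_of_nonneg hP.le]
      exact Real.pi_pos.ne
  simp_rw [key, mul_assoc (_ * _ : ℂ)]
  rw [integral_const_mul]
  have h := integral_cpow_mul_mellin_rayCorr h0 h1 (inv_pos.2 hP)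
  simp_rw [mul_assoc] at h ⊢
  rw [h, Fin.prod_univ_castSucc]
  simp only [Fin.snoc_castSucc, Fin.snoc_last, Complex.real_smul]
  rw [rayCorrPos_of_pos δ (inv_pos.2 hP)]
  ring

/-- The inner integral over the orthant of the moment kernel. -/
theorem integral_moment_kernel_left {δ : ℝ} (h0 : 0 < δ) (h1 : δ < Real.pi) (n : ℕ) (t : ℝ) :
    ∫ v, (∏ j, (v j : ℂ) ^ (1 / 2 + Complex.I * (t : ℂ) - 1) * rayCorrPos δ (v j)) *
      (Complex.exp (Complex.I * ((Real.pi - δ) / 2 : ℝ)) * Real.pi * (zetaWeight δ (-t) : ℝ))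
        ∂orthantMeasure n =
    (Complex.exp (Complex.I * ((Real.pi - δ) / 2 : ℝ)) * Real.pi) ^ (n + 1) *
      ((zetaWeight δ (-t) ^ (n + 1) : ℝ) : ℂ) := by
  have hm : ∫ x in Ioi (0 : ℝ), (x : ℂ) ^ (1 / 2 + Complex.I * (t : ℂ) - 1) * rayCorrPos δ x =
      Complex.exp (Complex.I * ((Real.pi - δ) / 2 : ℝ)) * Real.pi * (zetaWeight δ (-t) : ℝ) := by
    rw [← mellin_rayCorr h0 h1]
    refine setIntegral_congr_fun measurableSet_Ioi fun u hu => ?_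
    rw [rayCorrPos_of_pos δ hu]
    rfl
  -- The n coordinate integrals each reproduce the factor already present from inversion, whence the
  -- power n + 1.
  rw [integral_mul_const, orthantMeasure_eq_pi, integral_fintype_prod_eq_prod
    (f := fun _ (x : ℝ) => (x : ℂ) ^ (1 / 2 + Complex.I * (t : ℂ) - 1) * rayCorrPos δ x), hm]
  rw [Finset.prod_const, Finset.card_univ, Fintype.card_fin, ← pow_succ, mul_pow]
  push_cast
  rfl

theorem moment_formula_rayCorrPos {δ : ℝ} (h0 : 0 < δ) (h1 : δ < Real.pi) (n : ℕ) :
    Integrable (fun u : Fin (n + 1) → ℝ => ∏ j, rayCorrPos δ (u j)) (surfaceMeasure (n + 1)) ∧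
    2 * Real.pi * ∫ u, ∏ j, rayCorrPos δ (u j) ∂surfaceMeasure (n + 1) =
      (Complex.exp (Complex.I * ((Real.pi - δ) / 2 : ℝ)) * Real.pi) ^ (n + 1) *
        ((∫ t, zetaWeight δ t ^ (n + 1) : ℝ) : ℂ) := by
  have hK := integrable_moment_kernel h0 h1 n
  have hB := measurable_rayCorrPos h0 h1
  have hmeas : AEStronglyMeasurable (fun u : Fin (n + 1) → ℝ => ∏ j, rayCorrPos δ (u j))
      (surfaceMeasure (n + 1)) := by
    have hB' : ∀ j, Measurable fun u : Fin (n + 1) → ℝ => rayCorrPos δ (u j) := fun j =>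
      hB.comp (by fun_prop)
    exact Measurable.aestronglyMeasurable (by fun_prop)
  have hpi : (2 * Real.pi : ℂ) ≠ 0 :=
    mul_ne_zero two_ne_zero (Complex.ofReal_ne_zero.2 Real.pi_ne_zero)
  have hae := (ae_orthant_pos n).mono fun v hv => integral_moment_kernel_right h0 h1 hv
  constructor
  · rw [integrable_surfaceMeasure_iff hmeas]
    have := hK.integral_prod_left.congr hae
    exact (integrable_const_mul_iff hpi.isUnit _).1 this
  · rw [integral_surfaceMeasure hmeas, ← integral_const_mul, ← integral_congr_ae hae,
      integral_integral_swap hK]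
    simp_rw [integral_moment_kernel_left h0 h1 n]
    rw [integral_const_mul, integral_complex_ofReal,
      integral_neg_eq_self (fun t => zetaWeight δ t ^ (n + 1))]

/-! ### The theorem -/

theorem theorem1 :
    -- the integral defining the autocorrelation converges on the right half-plane,
    -- and it has an analytic continuation to the slit plane
    (∀ z : ℂ, 0 < z.re →
      IntegrableOn (fun x : ℝ => phi1 ((x : ℂ) * z) * phi1 (x : ℂ)) (Ioi 0)) ∧
    (∃ A : ℂ → ℂ, IsAutocorrContinuation A) ∧
    -- the surface measure is locally finite, carried by the hypersurface, and is the limit of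
    -- the normalized indicators as a distribution
    (∀ k : ℕ, 1 ≤ k →
      IsLocallyFiniteMeasure (surfaceMeasure k) ∧
      surfaceMeasure k ({u | (∀ j, 0 < u j) ∧ ∏ j, u j = 1}ᶜ) = 0 ∧
      ∀ g : (Fin k → ℝ) → ℝ, Continuous g → HasCompactSupport g →
        Tendsto
          (fun ε : ℝ => ε⁻¹ *
            ∫ u in {u : Fin k → ℝ | (∀ j, 0 < u j) ∧ 1 ≤ ∏ j, u j ∧ ∏ j, u j ≤ 1 + ε}, g u)
          (𝓝[>] 0) (𝓝 (∫ u, g u ∂(surfaceMeasure k)))) ∧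
    surfaceMeasure 1 = Measure.dirac (fun _ => 1) ∧
    -- the moment formula
    ∀ A : ℂ → ℂ, IsAutocorrContinuation A →
      ∀ k : ℕ, 1 ≤ k → ∀ δ : ℝ, 0 < δ → δ < Real.pi →
        Integrable (fun t : ℝ => ‖riemannZeta (1 / 2 + Complex.I * (t : ℂ))‖ ^ (2 * k) *
          (Real.exp (k * (Real.pi - δ) * t) / Real.cosh (Real.pi * t) ^ k)) ∧
        Integrable (fun u : Fin k → ℝ =>
          ∏ j, A (-((u j : ℂ) * Complex.exp (Complex.I * (δ : ℂ))))) (surfaceMeasure k) ∧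
        ((∫ t : ℝ, ‖riemannZeta (1 / 2 + Complex.I * (t : ℂ))‖ ^ (2 * k) *
          (Real.exp (k * (Real.pi - δ) * t) / Real.cosh (Real.pi * t) ^ k) : ℝ) : ℂ) =
        2 * (Complex.exp (Complex.I * (k : ℂ) * (((δ : ℂ) - (Real.pi : ℂ)) / 2)) /
            (Real.pi : ℂ) ^ (k - 1)) *
          ∫ u : Fin k → ℝ,
            ∏ j, A (-((u j : ℂ) * Complex.exp (Complex.I * (δ : ℂ)))) ∂(surfaceMeasure k) := by
  refine ⟨fun z hz => ?_, ⟨autocorrExt, isAutocorrContinuation_autocorrExt⟩, fun k hk => ?_,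
    surfaceMeasure_one, fun A hA k hk δ h0 h1 => ?_⟩
  · simpa using integrableOn_phi1_mul_phi1 hz (q := 1) (by simp)
  · obtain ⟨n, rfl⟩ := Nat.exists_eq_add_of_le' hk
    exact ⟨isLocallyFiniteMeasure_surfaceMeasure n, ae_surfaceMeasure n,
      fun g hg hc => tendsto_slab n hg hc⟩
  · obtain ⟨n, rfl⟩ := Nat.exists_eq_add_of_le' hk
    simp_rw [← zetaWeight_pow]
    have hEq := hA.eqOn isAutocorrContinuation_autocorrExt
    have hae : (fun u : Fin (n + 1) → ℝ => ∏ j, rayCorrPos δ (u j))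
        =ᵐ[surfaceMeasure (n + 1)] fun u =>
          ∏ j, A (-((u j : ℂ) * Complex.exp (Complex.I * (δ : ℂ)))) := by
      filter_upwards [ae_surfaceMeasure n] with u hu
      refine Finset.prod_congr rfl fun j _ => ?_
      rw [rayCorrPos_of_pos δ (hu.1 j), hEq (neg_mul_exp_mem_slitPlane h0 h1 (hu.1 j)), rayCorr]
    obtain ⟨hint, hval⟩ := moment_formula_rayCorrPos h0 h1 n
    refine ⟨integrable_zetaWeight_pow h0 h1 hk, hint.congr hae, ?_⟩
    rw [← integral_congr_ae hae]
    have hpi : (Real.pi : ℂ) ≠ 0 := Complex.ofReal_ne_zero.2 Real.pi_ne_zero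
    -- The phase in the statement is ω^(-k), cancelling the ω^k of the k Mellin transforms; π^k
    -- against 2π leaves 2/π^(k-1).
    have hexp : Complex.exp (Complex.I * ((n + 1 : ℕ) : ℂ) * (((δ : ℂ) - (Real.pi : ℂ)) / 2)) *
        Complex.exp (Complex.I * ((Real.pi - δ) / 2 : ℝ)) ^ (n + 1) = 1 := by
      rw [← Complex.exp_nat_mul, ← Complex.exp_add, ← Complex.exp_zero]
      congr 1
      push_cast
      ring
    rw [Nat.add_sub_cancel]
    refine mul_left_cancel₀ (mul_ne_zero (pow_ne_zero (n + 1) hpi) (pow_ne_zero (n + 1)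
      (Complex.exp_ne_zero (Complex.I * ((Real.pi - δ) / 2 : ℝ))))) ?_
    rw [mul_pow] at hval
    rw [mul_comm (_ ^ (n + 1)), ← hval]
    generalize Complex.exp (Complex.I * ((n + 1 : ℕ) : ℂ) * (((δ : ℂ) - (Real.pi : ℂ)) / 2)) = E
      at hexp ⊢
    generalize Complex.exp (Complex.I * ((Real.pi - δ) / 2 : ℝ)) ^ (n + 1) = F at hexp ⊢
    generalize ∫ u, ∏ j, rayCorrPos δ (u j) ∂surfaceMeasure (n + 1) = J
    have h : F * (Real.pi : ℂ) ^ (n + 1) * (2 * (E / (Real.pi : ℂ) ^ n) * J) =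
        2 * Real.pi * J * (E * F) := by
      field_simp
      ring
    rw [h, hexp, mul_one]
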